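/- **Definitions.** A $k$-state binary quantum generator consists of a vector $\psi_0\in\mathbb C^k$ of $\ell_2$-norm 1, a unitary $U$ on $\mathbb C^k$ and a partition of the $k$ basis states into two nonempty sets, with associated coordinate projections $M_0,M_1$. Its $n$-bit output distribution gives $x\in\{0,1\}^n$ the probability $\|M_{x_n}U\cdots M_{x_1}U\psi_0\|_2^2$. For $S\subseteq\{1,\dots,n\}$ let $f_S(x)=\bigoplus_{i\in S}x_i$. For $\eta\in(0,1/2)$ let $P_{S,\eta}$ be the distribution of the $(n+1)$-bit string $(x,f_S(x)\oplus e)$, where $x\in\{0,1\}^n$ is uniform and $e\in\{0,1\}$ is independent of $x$ with $\Pr[e=1]=\eta$. KL-divergence and the binary entropy $H$ are measured in bits. Algorithms are randomized; $\varepsilon$ and $\delta$ range over reciprocals of positive integers, and running-time bounds hold in the worst case. *Noisy Parity Learning conjecture.* There is a constant $\eta\in(0,1/2)$ for which no algorithm with the following property exists: given $n,\varepsilon,\delta$ and independent examples from $P_{S,\eta}$, for any unknown $S\subseteq\{1,\dots,n\}$, it runs in time polynomial in $n,1/\varepsilon,1/\delta$ and, with probability at least $1-\delta$, outputs a Boolean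 circuit computing a function $f'$ with $\Pr_x[f'(x)\ne f_S(x)]<\varepsilon$ for uniform $x\in\{0,1\}^n$. **Theorem.** 1. If the Noisy Parity Learning conjecture holds, then no algorithm has the following property: given $n,k,\varepsilon,\delta$ and independent examples from the $n$-bit output distribution $D$ of any unknown $k$-state binary quantum generator, it runs in time polynomial in $n,k,1/\varepsilon,\log(1/\delta)$ and, with probability at least $1-\delta$, outputs a circuit that computes (its output bits being read as a binary fixed-point number) a probability distribution $E$ on $\{0,1\}^n$ with $\mathrm{KL}(D\|E)<\varepsilon$. 2. For all $n\ge 0$, $S\subseteq\{1,\dots,n\}$ and $\eta\in(0,1/2)$, the following is a $4(n+1)$-state binary quantum generator whose $(n+1)$-bit output distribution is exactly $P_{S,\eta}$. The basis states are $(j,k,\ell)\in\{0,\dots,n\}\times\{0,1\}^2$, and the start state is the basis state $(0,0,0)$. Column $(j,k,\ell)$ of $U$ has exactly two nonzero entries: for $j<n$, these are $1/\sqrt2$ and $i/\sqrt2$ in the respective rows $(j+1,k,\ell),(j+1,k,\ell\oplus1)$ if $j+1\notin S$; $(j+1,k,\ell),(j+1,k\oplus1,\ell)$ if $j+1=\min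 S$; and $(j+1,k\oplus\ell,k),(j+1,1\oplus k\oplus\ell,k)$ if $j+1\in S\setminus\{\min S\}$. For $j=n$ they are $\sqrt{1-\eta}$ in row $(0,k,\ell)$ and $i\sqrt\eta$ in row $(0,k\oplus1,\ell)$. The outcome associated with $(j,k,\ell)$ is $\ell$ if $j\notin\{0\}\cup S$, is $k\oplus\ell$ if $j\in S\setminus\{\min S\}$, and is $k$ otherwise. 3. Let $n\ge 0$, $S\subseteq\{1,\dots,n\}$, $\eta\in(0,1/2)$ and $\varepsilon>0$, and let $E$ be a probability distribution on $\{0,1\}^{n+1}$ with $\mathrm{KL}(P_{S,\eta}\|E)\le\varepsilon(1-H(\eta))$. Then every $h:\{0,1\}^n\to\{0,1\}$ such that $h(x)=b$ whenever $E(x,b)>E(x,1-b)$ satisfies $\Pr_x[h(x)\ne f_S(x)]\le\varepsilon$ for uniform $x\in\{0,1\}^n$. -/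

import Mathlib

open scoped ENNReal BigOperators

/-! ## Quantum generators with binary measurement outcomes -/

namespace QG

/-- A binary quantum generator whose basis states are indexed by `ι`: an initial vector of
`ℓ²`-norm one, a unitary matrix, and a partition of the basis states into two (nonempty) blocks,
the blocks being the fibres of `outcome`.  A `k`-state generator is one with `k` basis states. -/
structure QuantumGenerator (ι : Type*) [Fintype ι] [DecidableEq ι] where
  /-- the initial state -/
  init : ι → ℂ
  init_norm : ∑ i, ‖init i‖ ^ 2 = 1
  /-- the unitary transformation -/
  U : Matrix ι ι ℂ
  unitary : U ∈ Matrix.unitaryGroup ι ℂ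
  /-- the measurement outcome with which a basis state is associated -/
  outcome : ι → Bool
  outcome_surjective : Function.Surjective outcome

namespace QuantumGenerator

variable {ι : Type*} [Fintype ι] [DecidableEq ι] (G : QuantumGenerator ι)

/-- The projection `M_σ` onto the coordinates associated with the outcome `σ`. -/
def proj (σ : Bool) (v : ι → ℂ) : ι → ℂ := fun i => if G.outcome i = σ then v i else 0

/-- `amplitude [x₁, …, xₙ] v` is the vector `M_{xₙ} U ⋯ M_{x₁} U v`. -/
def amplitude (x : List Bool) (v : ι → ℂ) : ι → ℂ :=
  x.foldl (fun w σ => G.proj σ (Matrix.mulVec G.U w)) v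

/-- The probability `‖M_{xₙ} U ⋯ M_{x₁} U ψ₀‖²` of the output `x₁, …, xₙ`. -/
noncomputable def outputProb {n : ℕ} (x : Fin n → Bool) : ℝ :=
  ∑ i, ‖G.amplitude (List.ofFn x) G.init i‖ ^ 2

theorem sum_norm_sq_mulVec (v : ι → ℂ) :
    ∑ i, ‖Matrix.mulVec G.U v i‖ ^ 2 = ∑ i, ‖v i‖ ^ 2 := by
  have key : ∀ w : ι → ℂ, ((∑ i, ‖w i‖ ^ 2 : ℝ) : ℂ) = star w ⬝ᵥ w := by
    intro w
    simp only [dotProduct, Pi.star_apply, RCLike.star_def, Complex.ofReal_sum]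
    refine Finset.sum_congr rfl fun i _ => ?_
    rw [mul_comm, Complex.mul_conj, Complex.normSq_eq_norm_sq]
  have h : star G.U * G.U = 1 := (Matrix.mem_unitaryGroup_iff').1 G.unitary
  have : star (Matrix.mulVec G.U v) ⬝ᵥ Matrix.mulVec G.U v = star v ⬝ᵥ v := by
    rw [Matrix.star_mulVec, Matrix.dotProduct_mulVec, Matrix.vecMul_vecMul,
      ← Matrix.star_eq_conjTranspose, h, Matrix.vecMul_one]
  rw [← key, ← key] at this
  exact_mod_cast this

theorem sum_norm_sq_proj (v : ι → ℂ) :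
    ∑ σ : Bool, ∑ i, ‖G.proj σ v i‖ ^ 2 = ∑ i, ‖v i‖ ^ 2 := by
  rw [Finset.sum_comm]
  refine Finset.sum_congr rfl fun i _ => ?_
  cases h : G.outcome i <;> simp [proj, h]

theorem sum_amplitude (n : ℕ) (v : ι → ℂ) :
    ∑ x : Fin n → Bool, ∑ i, ‖G.amplitude (List.ofFn x) v i‖ ^ 2 = ∑ i, ‖v i‖ ^ 2 := by
  induction n generalizing v with
  | zero => simp [amplitude]
  | succ n ih =>
    rw [← (Fin.consEquiv fun _ : Fin (n + 1) => Bool).sum_comp, Fintype.sum_prod_type]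
    have : ∀ (σ : Bool) (x : Fin n → Bool),
        G.amplitude (List.ofFn ((Fin.consEquiv fun _ : Fin (n + 1) => Bool) (σ, x))) v
          = G.amplitude (List.ofFn x) (G.proj σ (Matrix.mulVec G.U v)) := by
      intro σ x
      simp [amplitude, Fin.consEquiv, List.ofFn_succ]
    simp only [this, ih]
    rw [sum_norm_sq_proj, sum_norm_sq_mulVec]

/-- The `n`-symbol output distribution of a quantum generator. -/
noncomputable def outputDist (n : ℕ) : PMF (Fin n → Bool) :=
  PMF.ofFintype (fun x => ENNReal.ofReal (G.outputProb x)) (by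
    rw [← ENNReal.ofReal_sum_of_nonneg fun x _ => by unfold outputProb; positivity]
    simp only [outputProb]
    rw [sum_amplitude, G.init_norm, ENNReal.ofReal_one])

end QuantumGenerator

/-! ## Parity functions, noisy examples, Kullback-Leibler divergence -/

/-- The parity function `f_S(x) = ⨁_{i ∈ S} x_i`. -/
def parity {n : ℕ} (S : Finset (Fin n)) (x : Fin n → Bool) : Bool :=
  decide (Odd (S.filter fun i => x i = true).card)

/-- A noise bit, equal to `true` with probability `η`. -/
noncomputable def noiseBit (η : ℝ) (hη : η ∈ Set.Ioo (0 : ℝ) (1 / 2)) : PMF Bool :=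
  PMF.ofFintype (fun e => ENNReal.ofReal (if e then η else 1 - η)) (by
    have h0 : (0 : ℝ) ≤ η := hη.1.le
    have h1 : (0 : ℝ) ≤ 1 - η := by linarith [hη.2]
    simp [← ENNReal.ofReal_add h0 h1])

/-- The distribution of a noisy labelled example `(x, f_S(x) ⊕ e)` with uniform `x ∈ {0,1}ⁿ` and
independent noise bit `e`; the label is the last bit. -/
noncomputable def noisyParity {n : ℕ} (S : Finset (Fin n)) (η : ℝ)
    (hη : η ∈ Set.Ioo (0 : ℝ) (1 / 2)) : PMF (Fin (n + 1) → Bool) :=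
  (PMF.uniformOfFintype (Fin n → Bool)).bind fun x =>
    (noiseBit η hη).map fun e => Fin.snoc x (xor (parity S x) e)

/-- The Kullback-Leibler divergence `KL(P‖Q)`, measured in bits. -/
noncomputable def klBits {α : Type*} [MeasurableSpace α] (P Q : PMF α) : ℝ≥0∞ :=
  InformationTheory.klDiv P.toMeasure Q.toMeasure / ENNReal.ofReal (Real.log 2)

/-- The binary entropy function, in bits. -/
noncomputable def entropyBits (η : ℝ) : ℝ := Real.binEntropy η / Real.log 2

/-- The probability, over a uniform `x ∈ {0,1}ⁿ`, that `h(x) ≠ f(x)`. -/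
noncomputable def errorRate {n : ℕ} (f h : (Fin n → Bool) → Bool) : ℝ :=
  ((Finset.univ.filter fun x => h x ≠ f x).card : ℝ) / 2 ^ n

/-! ## The generator of noisy parities -/

/-- The basis states `(j, k, ℓ)` with `j ∈ {0, …, n}` and `k, ℓ ∈ {0, 1}`. -/
abbrev ParityState (n : ℕ) : Type := Fin (n + 1) × Bool × Bool

/-- `s` is the least element of `S`. -/
abbrev IsMin {n : ℕ} (S : Finset (Fin n)) (s : Fin n) : Prop := s ∈ S ∧ ∀ s' ∈ S, s ≤ s'

/-- The transition matrix.  The column `(j, k, ℓ)` is supported on the rows with first index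
`j + 1 mod (n + 1)`; the variable `s : Fin n` stands for the bit number `s + 1` of `1, …, n`. -/
noncomputable def parityMatrix {n : ℕ} (S : Finset (Fin n)) (η : ℝ) :
    Matrix (ParityState n) (ParityState n) ℂ :=
  Matrix.of fun row col =>
    let k := col.2.1
    let l := col.2.2
    Fin.lastCases (motive := fun _ => ℂ)
      (if row = (0, k, l) then (Real.sqrt (1 - η) : ℂ)
        else if row = (0, !k, l) then Complex.I * (Real.sqrt η : ℂ)
        else 0)
      (fun s : Fin n =>
        if s ∉ S then
          if row = (s.succ, k, l) then 1 / (Real.sqrt 2 : ℂ)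
          else if row = (s.succ, k, !l) then Complex.I / (Real.sqrt 2 : ℂ)
          else 0
        else if IsMin S s then
          if row = (s.succ, k, l) then 1 / (Real.sqrt 2 : ℂ)
          else if row = (s.succ, !k, l) then Complex.I / (Real.sqrt 2 : ℂ)
          else 0
        else
          if row = (s.succ, xor k l, k) then 1 / (Real.sqrt 2 : ℂ)
          else if row = (s.succ, !(xor k l), k) then Complex.I / (Real.sqrt 2 : ℂ)
          else 0)
      col.1

/-- The measurement outcome associated with the basis state `(j, k, ℓ)`: it is `ℓ` if
`j ∉ {0} ∪ S`, it is `k ⊕ ℓ` if `j ∈ S` is not the minimum of `S`, and it is `k` otherwise. -/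
def parityOutcome {n : ℕ} (S : Finset (Fin n)) (i : ParityState n) : Bool :=
  let k := i.2.1
  let l := i.2.2
  Fin.cases (motive := fun _ => Bool) k
    (fun s : Fin n => if s ∉ S then l else if IsMin S s then k else xor k l) i.1

/-! ## Boolean circuits -/

/-- The gates of a circuit.  References to gates are relative:
`not i` reads the value of the `i`-th most recent gate before it (`i = 0` being its immediate
predecessor), and similarly for the other gates.  `input i` reads the `i`-th input bit.
References to gates or inputs that do not exist read the value `false`. -/
inductive Gate where
  | input (i : ℕ)
  | const (b : Bool)
  | not (i : ℕ)
  | and (i j : ℕ)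
  | or (i j : ℕ)

/-- The value of a gate, given the input and the list of the values of all previous gates, most
recent first. -/
def Gate.eval {n : ℕ} (x : Fin n → Bool) (w : List Bool) : Gate → Bool
  | .input i => if h : i < n then x ⟨i, h⟩ else false
  | .const b => b
  | .not i => !(w.getD i false)
  | .and i j => w.getD i false && w.getD j false
  | .or i j => w.getD i false || w.getD j false

/-- A Boolean circuit: its gates in topological order, and the number of its output bits.  The
outputs are the last gates: output number `i` is the `i`-th most recent gate. -/
structure Circuit where
  numOut : ℕ
  gates : List Gate

namespace Circuit

/-- The values of all gates on the input `x`, last gate first. -/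
def wires (C : Circuit) {n : ℕ} (x : Fin n → Bool) : List Bool :=
  C.gates.foldl (fun w g => g.eval x w :: w) []

/-- Output bit number `i`. -/
def out (C : Circuit) {n : ℕ} (x : Fin n → Bool) (i : ℕ) : Bool :=
  decide (i < C.numOut) && (C.wires x).getD i false

/-- The Boolean function computed by a circuit. -/
def fn (C : Circuit) {n : ℕ} (x : Fin n → Bool) : Bool := C.out x 0

/-- The number computed by a circuit: its outputs are read as the binary fixed-point number
`b₀.b₁b₂b₃…`. -/
noncomputable def value (C : Circuit) {n : ℕ} (x : Fin n → Bool) : ℝ :=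
  ∑ i ∈ Finset.range C.numOut, if C.out x i then (1 / 2 : ℝ) ^ i else 0

end Circuit

/-- The self-delimiting unary code of a number. -/
def unary (i : ℕ) : List Bool := List.replicate i true ++ [false]

/-- The description of a gate as a bit string. -/
def Gate.encode : Gate → List Bool
  | .input i => false :: false :: unary i
  | .const b => [false, true, b]
  | .not i => true :: false :: unary i
  | .and i j => true :: true :: false :: (unary i ++ unary j)
  | .or i j => true :: true :: true :: (unary i ++ unary j)

/-- The description of a circuit as a bit string. -/
def Circuit.encode (C : Circuit) : List Bool :=
  unary C.numOut ++ C.gates.flatMap Gate.encode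

theorem unary_append_inj {i j : ℕ} {u v : List Bool} (h : unary i ++ u = unary j ++ v) :
    i = j ∧ u = v := by
  induction i generalizing j with
  | zero => cases j <;> simp_all [unary, List.replicate_succ]
  | succ i ih =>
    cases j with
    | zero => simp_all [unary, List.replicate_succ]
    | succ j =>
      have := @ih j (by simpa [unary, List.replicate_succ] using h)
      simpa using this

theorem Gate.encode_append_inj {g g' : Gate} {u v : List Bool}
    (h : g.encode ++ u = g'.encode ++ v) : g = g' ∧ u = v := by
  cases g <;> cases g' <;> simp [Gate.encode] at h ⊢
  case input.input i j => exact unary_append_inj h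
  case const.const b c => exact h
  case not.not i j => exact unary_append_inj h
  all_goals
    obtain ⟨h1, h2⟩ := unary_append_inj h
    obtain ⟨h3, h4⟩ := unary_append_inj h2
    exact ⟨⟨h1, h3⟩, h4⟩

/-- A bit string describes at most one circuit. -/
theorem Circuit.encode_injective : Function.Injective Circuit.encode := by
  rintro ⟨p, gs⟩ ⟨q, gs'⟩ h
  obtain ⟨h1, h2⟩ := unary_append_inj h
  simp only at h1 h2
  subst h1
  congr 1
  clear h
  have ne : ∀ g : Gate, g.encode ≠ [] := by intro g; cases g <;> simp [Gate.encode]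
  induction gs generalizing gs' with
  | nil =>
    cases gs' with
    | nil => rfl
    | cons g gs' => simp [ne] at h2
  | cons g gs ih =>
    cases gs' with
    | nil => simp [ne] at h2
    | cons g' gs' =>
      simp only [List.flatMap_cons] at h2
      obtain ⟨rfl, h3⟩ := Gate.encode_append_inj h2
      rw [ih gs' h3]

/-! ## Randomized algorithms with access to random examples

Algorithms are structured programs for a machine with finitely many stacks of bits, that is (up to
a constant factor in the running time) multi-tape Turing machines.  Besides the elementary stack
operations, a program can toss a fair coin and can ask for a fresh random example. -/

/-- Programs; the numbers `r` are the names of stacks. -/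
inductive Prog where
  /-- do nothing -/
  | skip
  /-- push a bit on a stack -/
  | push (r : ℕ) (b : Bool)
  /-- remove the top of a stack, if there is one -/
  | pop (r : ℕ)
  /-- push the result of a fresh coin toss on a stack -/
  | toss (r : ℕ)
  /-- push the bits of a fresh example on a stack, the first bit on top -/
  | draw (r : ℕ)
  /-- run two programs one after the other -/
  | seq (P Q : Prog)
  /-- run `P`, `Q` or `R` according as the top of a stack is `true`, `false` or missing -/
  | branch (r : ℕ) (P Q R : Prog)
  /-- run `P` over and over as long as a stack is not empty -/
  | loop (r : ℕ) (P : Prog)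

/-- The memory of the machine: the contents of the stacks (top first), and the numbers of examples
and of coin tosses that have been used up. -/
structure Config where
  stack : ℕ → List Bool
  drawn : ℕ
  tossed : ℕ

/-- Replace the contents of one stack. -/
def Config.set (c : Config) (r : ℕ) (l : List Bool) : Config :=
  { c with stack := Function.update c.stack r l }

/-- `Runs ex coin P c t d`: with the sequence `ex` of examples and the sequence `coin` of coin
tosses, the program `P`, started in the configuration `c`, halts after exactly `t` steps in the
configuration `d`. -/
inductive Runs (ex : ℕ → List Bool) (coin : ℕ → Bool) : Prog → Config → ℕ → Config → Prop
  | skip (c : Config) : Runs ex coin .skip c 1 c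
  | push (c : Config) (r : ℕ) (b : Bool) :
      Runs ex coin (.push r b) c 1 (c.set r (b :: c.stack r))
  | pop (c : Config) (r : ℕ) : Runs ex coin (.pop r) c 1 (c.set r (c.stack r).tail)
  | toss (c : Config) (r : ℕ) : Runs ex coin (.toss r) c 1
      { c.set r (coin c.tossed :: c.stack r) with tossed := c.tossed + 1 }
  | draw (c : Config) (r : ℕ) : Runs ex coin (.draw r) c 1
      { c.set r (ex c.drawn ++ c.stack r) with drawn := c.drawn + 1 }
  | seq {P Q : Prog} {c d e : Config} {t u : ℕ} :
      Runs ex coin P c t d → Runs ex coin Q d u e → Runs ex coin (.seq P Q) c (t + u) e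
  | branch_true {r : ℕ} {P Q R : Prog} {c d : Config} {t : ℕ} :
      (c.stack r).head? = some true → Runs ex coin P c t d →
      Runs ex coin (.branch r P Q R) c (1 + t) d
  | branch_false {r : ℕ} {P Q R : Prog} {c d : Config} {t : ℕ} :
      (c.stack r).head? = some false → Runs ex coin Q c t d →
      Runs ex coin (.branch r P Q R) c (1 + t) d
  | branch_empty {r : ℕ} {P Q R : Prog} {c d : Config} {t : ℕ} :
      (c.stack r).head? = none → Runs ex coin R c t d →
      Runs ex coin (.branch r P Q R) c (1 + t) d
  | loop_done {r : ℕ} {P : Prog} {c : Config} :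
      c.stack r = [] → Runs ex coin (.loop r P) c 1 c
  | loop_step {r : ℕ} {P : Prog} {c d e : Config} {t u : ℕ} :
      c.stack r ≠ [] → Runs ex coin P c t d → Runs ex coin (.loop r P) d u e →
      Runs ex coin (.loop r P) c (1 + t + u) e

/-- The machine is deterministic once the examples and the coin tosses are given. -/
theorem Runs.deterministic {ex : ℕ → List Bool} {coin : ℕ → Bool} {P : Prog} {c d d' : Config}
    {t t' : ℕ} (h : Runs ex coin P c t d) (h' : Runs ex coin P c t' d') : t = t' ∧ d = d' := by
  induction h generalizing t' d' with
  | skip | push | pop | toss | draw => cases h'; exact ⟨rfl, rfl⟩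
  | seq _ _ ih1 ih2 =>
    cases h' with
    | seq a b =>
      obtain ⟨rfl, rfl⟩ := ih1 a
      obtain ⟨rfl, rfl⟩ := ih2 b
      exact ⟨rfl, rfl⟩
  | branch_true hr _ ih | branch_false hr _ ih | branch_empty hr _ ih =>
    cases h' <;> simp_all
    all_goals first
      | exact ih (by assumption)
  | loop_done hr => cases h' <;> simp_all
  | loop_step hr _ _ ih1 ih2 =>
    cases h' with
    | loop_done h => exact absurd h hr
    | loop_step _ a b =>
      obtain ⟨rfl, rfl⟩ := ih1 a
      obtain ⟨rfl, rfl⟩ := ih2 b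
      exact ⟨rfl, rfl⟩

/-- The initial configuration: the arguments are on the stacks `0, 1, 2, …`, one on each, and all
other stacks are empty. -/
def start (args : List (List Bool)) : Config where
  stack r := args.getD r []
  drawn := 0
  tossed := 0

/-- The program `A`, given the arguments `args`, the examples `ex` and the coin tosses `coin`, halts
within `T` steps. -/
def HaltsWithin (A : Prog) (args : List (List Bool)) {N : ℕ} (ex : ℕ → Fin N → Bool)
    (coin : ℕ → Bool) (T : ℕ) : Prop :=
  ∃ t ≤ T, ∃ c, Runs (fun i => List.ofFn (ex i)) coin A (start args) t c

/-- The program `A`, given the arguments `args`, the examples `ex` and the coin tosses `coin`, halts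
and leaves the description of the circuit `C` on the stack `0`. -/
def Outputs (A : Prog) (args : List (List Bool)) {N : ℕ} (ex : ℕ → Fin N → Bool)
    (coin : ℕ → Bool) (C : Circuit) : Prop :=
  ∃ t c, Runs (fun i => List.ofFn (ex i)) coin A (start args) t c ∧ c.stack 0 = C.encode

/-- The probability that `A` outputs a circuit with the property `good`, when the examples are
independent with distribution `D` and the coin tosses are independent and fair. -/
noncomputable def successProb (A : Prog) (args : List (List Bool)) {N : ℕ}
    (D : PMF (Fin N → Bool)) (good : Circuit → Prop) : ℝ :=
  ((MeasureTheory.Measure.infinitePi fun _ : ℕ => D.toMeasure).prod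
    (MeasureTheory.Measure.infinitePi fun _ : ℕ =>
      (PMF.uniformOfFintype Bool).toMeasure)).real
    {ω : (ℕ → Fin N → Bool) × (ℕ → Bool) | ∃ C, Outputs A args ω.1 ω.2 C ∧ good C}

/-! ## Learning -/

/-- Parity functions are efficiently learnable under the uniform distribution with noise rate `η`:
there is an algorithm that, given `n`, `1/ε = a` (in unary), `1/δ = b` (in binary) and
noisy examples of a parity function `f` of `n` bits, always halts in time polynomial in `n`, `1/ε`
and `1/δ`, and with probability at least `1 - δ` outputs a circuit for a function that differs from
`f` with probability less than `ε`. -/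
def ParityLearnable (η : ℝ) (hη : η ∈ Set.Ioo (0 : ℝ) (1 / 2)) : Prop :=
  ∃ (A : Prog) (T : MvPolynomial (Fin 3) ℕ), ∀ n a b : ℕ, 1 ≤ a → 1 ≤ b →
    let args := [List.replicate n true, List.replicate a true, Nat.bits b]
    (∀ (ex : ℕ → Fin (n + 1) → Bool) (coin : ℕ → Bool),
      HaltsWithin A args ex coin (MvPolynomial.eval ![n, a, b] T)) ∧
    ∀ S : Finset (Fin n), 1 - 1 / (b : ℝ) ≤
      successProb A args (noisyParity S η hη) fun C => errorRate (parity S) C.fn < 1 / (a : ℝ)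

/-- The noisy parity learning conjecture. -/
def NoisyParityConjecture : Prop :=
  ∃ (η : ℝ) (hη : η ∈ Set.Ioo (0 : ℝ) (1 / 2)), ¬ ParityLearnable η hη

/-- The circuit `C` is an evaluator for a probability distribution `Q` on `{0,1}ⁿ` with
`KL(D‖Q) < ε`. -/
def IsEvaluator {n : ℕ} (D : PMF (Fin n → Bool)) (ε : ℝ) (C : Circuit) : Prop :=
  ∃ Q : PMF (Fin n → Bool), (∀ x, Q x = ENNReal.ofReal (C.value x)) ∧
    klBits D Q < ENNReal.ofReal ε

/-- The `n`-bit output distributions of `k`-state quantum generators are efficiently learnable under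
the Kullback-Leibler divergence: there is an algorithm that, given `n`, `k`, `1/ε = a` (in unary),
`1/δ = b` (in binary) and independent examples from the output distribution, always halts in
time polynomial in `n`, `k`, `1/ε` and `log (1/δ)`, and with probability at least `1 - δ` outputs an
evaluator circuit with Kullback-Leibler divergence less than `ε`. -/
def GeneratorsLearnable : Prop :=
  ∃ (A : Prog) (T : MvPolynomial (Fin 4) ℕ), ∀ n k a b : ℕ, 1 ≤ k → 1 ≤ a → 1 ≤ b →
    let args := [List.replicate n true, List.replicate k true, List.replicate a true, Nat.bits b]
    (∀ (ex : ℕ → Fin n → Bool) (coin : ℕ → Bool),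
      HaltsWithin A args ex coin (MvPolynomial.eval ![n, k, a, Nat.log 2 b] T)) ∧
    ∀ G : QuantumGenerator (Fin k), 1 - 1 / (b : ℝ) ≤
      successProb A args (G.outputDist n) (IsEvaluator (G.outputDist n) (1 / (a : ℝ)))

end QG

namespace QG

/-! ## Kullback-Leibler divergence of finitely supported distributions -/

/-! Noisy parities are output distributions of small quantum generators, and any distribution close
to them in divergence betrays the parity. A learner for generators therefore yields a learner for
noisy parities.

Generation: in every column the two nonzero entries lie in rows with opposite outcomes, so each
measurement leaves a multiple of a single basis vector, and the run is a classical random walk in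
which `k` carries the parity of the bits of `S` seen so far (`amplitude_parityGenerator`). Two
columns that share rows do so with the entries interchanged, and the factor `i` makes their cross
terms cancel (`mem_unitaryGroup_of_two_entries`).

Prediction: the divergence is a sum over strings of nonnegative terms `klTerm p q`, convex in `q`.
If each mistake of a predictor costs at least `κ / 2 ^ n`, its error rate is at most the divergence
over `κ` (`mul_errorRate_le_klDiv`). Choosing the likelier label gives `κ = log 2 - H(η)`, in nats.
The reduction uses a cruder rule with a smaller constant: compare `E(x, 0)` with `2 ^ (-(n + 1))`.
This tests only whether the leading output bits of the evaluator vanish, so the circuit needs only a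
few uniform gates appended (`exists_errorRate_predictor_lt`).

Reduction: an explicit program rescales the arguments, runs the given learner, and edits the
description of its circuit. The number of bits left on the stacks is bounded by the running time, so
the editing is polynomial too (`exists_run_parityLearner`). -/

/-- The contribution to the Kullback-Leibler divergence of a point with probabilities `p` and
`q`. -/
noncomputable def klTerm (p q : ℝ) : ℝ := p * Real.log (p / q) + q - p

theorem klTerm_eq {p q : ℝ} (hq : 0 < q) : klTerm p q = q * InformationTheory.klFun (p / q) := by
  unfold klTerm InformationTheory.klFun
  field_simp

theorem klTerm_nonneg {p q : ℝ} (hp : 0 ≤ p) (hq : 0 < q) : 0 ≤ klTerm p q := by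
  rw [klTerm_eq hq]
  exact mul_nonneg hq.le (InformationTheory.klFun_nonneg (by positivity))

/-- The contribution is bounded below by its tangent in `q`. -/
theorem klTerm_ge_tangent {p q r : ℝ} (hp : 0 < p) (hq : 0 < q) (hr : 0 < r) :
    p * Real.log (p / r) - p * (q / r) + q ≤ klTerm p q := by
  have h : Real.log (q / r) ≤ q / r - 1 := Real.log_le_sub_one_of_pos (by positivity)
  have h2 : Real.log (p / q) = Real.log (p / r) - Real.log (q / r) := by
    rw [Real.log_div hp.ne' hq.ne', Real.log_div hp.ne' hr.ne', Real.log_div hq.ne' hr.ne']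
    ring
  unfold klTerm
  rw [h2]
  nlinarith

/-- If `r` lies between `q` and `p`, moving `q` to `r` does not increase the contribution. -/
theorem klTerm_le_of_between {p q r : ℝ} (hp : 0 < p) (hq : 0 < q) (hr : 0 < r)
    (h : 0 ≤ (q - r) * (r - p)) : klTerm p r ≤ klTerm p q := by
  refine le_trans ?_ (klTerm_ge_tangent hp hq hr)
  unfold klTerm
  have : 0 ≤ (q - r) * (r - p) / r := by positivity
  -- The tangent at `r` has slope `1 - p / r`, so its rise from `r` to `q` is `(q - r) * (r - p) /
  -- r`.
  have e : (q - r) * (r - p) / r = q - p * (q / r) - (r - p) := by field_simp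
  linarith

theorem klTerm_pos {p q : ℝ} (hp : 0 < p) (hq : 0 < q) (h : p ≠ q) : 0 < klTerm p q := by
  refine lt_of_le_of_ne (klTerm_nonneg hp.le hq) fun h0 => h ?_
  rw [klTerm_eq hq] at h0
  have := (InformationTheory.klFun_eq_zero_iff (x := p / q) (by positivity)).1
    ((mul_eq_zero.1 h0.symm).resolve_left hq.ne')
  rwa [div_eq_one_iff_eq hq.ne'] at this

theorem klTerm_mul {c p q : ℝ} (hc : 0 < c) : klTerm (c * p) (c * q) = c * klTerm p q := by
  unfold klTerm
  rw [mul_div_mul_left _ _ hc.ne']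
  ring

theorem pos_of_klDiv_ne_top {α : Type*} [MeasurableSpace α] [MeasurableSingletonClass α]
    {P Q : PMF α} (h : InformationTheory.klDiv P.toMeasure Q.toMeasure ≠ ∞) {x : α}
    (hx : P x ≠ 0) : Q x ≠ 0 := by
  intro hQ
  have hac := (InformationTheory.klDiv_ne_top_iff.1 h).1
  have := hac (s := {x})
  rw [PMF.toMeasure_apply_singleton _ _ (measurableSet_singleton x),
    PMF.toMeasure_apply_singleton _ _ (measurableSet_singleton x)] at this
  exact hx (this hQ)

/-- Finite divergence forces absolute continuity, and `P` has full support, so `Q` has too. Hence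
the Radon-Nikodym derivative is the quotient of the point masses at every point. -/
theorem toReal_klDiv_eq_sum {α : Type*} [Fintype α] [MeasurableSpace α]
    [MeasurableSingletonClass α] {P Q : PMF α}
    (h : InformationTheory.klDiv P.toMeasure Q.toMeasure ≠ ∞) (hP : ∀ x, P x ≠ 0) :
    (InformationTheory.klDiv P.toMeasure Q.toMeasure).toReal
      = ∑ x, klTerm (P x).toReal (Q x).toReal := by
  have hac := (InformationTheory.klDiv_ne_top_iff.1 h).1
  rw [InformationTheory.toReal_klDiv_eq_integral_klFun hac, MeasureTheory.integral_fintype]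
  · refine Finset.sum_congr rfl fun x => fun _ => ?_
    have hQ : 0 < (Q x).toReal :=
      ENNReal.toReal_pos (pos_of_klDiv_ne_top h (hP x)) (PMF.apply_ne_top _ _)
    have hx : P.toMeasure.rnDeriv Q.toMeasure x * Q x = P x := by
      have := congrArg (fun μ => μ {x})
        (MeasureTheory.Measure.withDensity_rnDeriv_eq P.toMeasure Q.toMeasure hac)
      simp only [MeasureTheory.withDensity_apply _ (measurableSet_singleton x),
        MeasureTheory.lintegral_singleton] at this
      rwa [PMF.toMeasure_apply_singleton _ _ (measurableSet_singleton x),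
        PMF.toMeasure_apply_singleton _ _ (measurableSet_singleton x)] at this
    rw [klTerm_eq hQ, MeasureTheory.measureReal_def,
      PMF.toMeasure_apply_singleton _ _ (measurableSet_singleton x), smul_eq_mul, ← hx,
      ENNReal.toReal_mul, mul_div_cancel_right₀ _ hQ.ne']
  · exact MeasureTheory.Integrable.of_finite

/-! ## From evaluators for noisy parities to predictors for parities -/

theorem noisyParity_snoc {n : ℕ} (S : Finset (Fin n)) (η : ℝ) (hη : η ∈ Set.Ioo (0 : ℝ) (1 / 2))
    (x : Fin n → Bool) (b : Bool) :
    noisyParity S η hη (Fin.snoc (α := fun _ => Bool) x b)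
      = ENNReal.ofReal ((1 / 2) ^ n * if b = parity S x then 1 - η else η) := by
  have h0 : (0 : ℝ) ≤ 1 - η := by linarith [hη.2]
  unfold noisyParity
  rw [PMF.bind_apply, tsum_fintype, Finset.sum_eq_single x]
  · rw [PMF.map_apply, tsum_fintype, Fintype.sum_bool]
    have hs : ∀ b c : Bool, (Fin.snoc (α := fun _ => Bool) x b = Fin.snoc (α := fun _ => Bool) x c)
        = (b = c) := fun b c => propext (Fin.snoc_right_injective _).eq_iff
    simp only [hs]
    rw [ENNReal.ofReal_mul (by positivity), PMF.uniformOfFintype_apply]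
    congr 1
    · rw [ENNReal.ofReal_pow (by norm_num)]
      simp [ENNReal.inv_pow]
    · cases b <;> cases parity S x <;> simp [noiseBit]
  · intro y _ hy
    rw [PMF.map_apply, ENNReal.tsum_eq_zero.2, mul_zero]
    intro e
    rw [if_neg]
    intro h
    exact hy (Fin.snoc_injective2 h).1.symm
  · simp

theorem toReal_noisyParity {n : ℕ} (S : Finset (Fin n)) (η : ℝ)
    (hη : η ∈ Set.Ioo (0 : ℝ) (1 / 2)) (x : Fin n → Bool) (b : Bool) :
    (noisyParity S η hη (Fin.snoc (α := fun _ => Bool) x b)).toReal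
      = (1 / 2) ^ n * if b = parity S x then 1 - η else η := by
  rw [noisyParity_snoc, ENNReal.toReal_ofReal]
  have h0 : (0 : ℝ) ≤ 1 - η := by linarith [hη.2]
  have := hη.1.le
  split_ifs <;> positivity

theorem noisyParity_ne_zero {n : ℕ} (S : Finset (Fin n)) (η : ℝ)
    (hη : η ∈ Set.Ioo (0 : ℝ) (1 / 2)) (z : Fin (n + 1) → Bool) :
    noisyParity S η hη z ≠ 0 := by
  rw [← Fin.snoc_init_self (α := fun _ => Bool) z, noisyParity_snoc, Ne, ENNReal.ofReal_eq_zero,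
    not_le]
  have h0 : (0 : ℝ) < 1 - η := by linarith [hη.2]
  have := hη.1
  split_ifs <;> positivity

/-- If every error of the predictor `h` contributes at least `κ / 2 ^ n` to the divergence, then
its error rate is at most `KL / κ`. -/
theorem mul_errorRate_le_klDiv {n : ℕ} {S : Finset (Fin n)} {η : ℝ}
    {hη : η ∈ Set.Ioo (0 : ℝ) (1 / 2)} {Q : PMF (Fin (n + 1) → Bool)}
    (hkl : InformationTheory.klDiv (noisyParity S η hη).toMeasure Q.toMeasure ≠ ∞)
    (h : (Fin n → Bool) → Bool) (κ : ℝ)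
    (hκ : ∀ x, h x ≠ parity S x → κ * (1 / 2) ^ n ≤
      klTerm ((1 / 2) ^ n * (1 - η))
        (Q (Fin.snoc (α := fun _ => Bool) x (parity S x))).toReal +
      klTerm ((1 / 2) ^ n * η) (Q (Fin.snoc (α := fun _ => Bool) x (!parity S x))).toReal) :
    κ * errorRate (parity S) h ≤
      (InformationTheory.klDiv (noisyParity S η hη).toMeasure Q.toMeasure).toReal := by
  have hη0 := hη.1
  have hη1 : 0 < 1 - η := by linarith [hη.2]
  have hQ : ∀ z, 0 < (Q z).toReal := fun z =>
    ENNReal.toReal_pos (pos_of_klDiv_ne_top hkl (noisyParity_ne_zero S η hη z))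
      (PMF.apply_ne_top _ _)
  rw [toReal_klDiv_eq_sum hkl (noisyParity_ne_zero S η hη),
    ← (Fin.snocEquiv fun _ : Fin (n + 1) => Bool).sum_comp, Fintype.sum_prod_type_right]
  have key : ∀ x : Fin n → Bool, (if h x ≠ parity S x then κ * (1 / 2) ^ n else 0) ≤
      ∑ b : Bool, klTerm (noisyParity S η hη (Fin.snoc (α := fun _ => Bool) x b)).toReal
        (Q (Fin.snoc (α := fun _ => Bool) x b)).toReal := by
    intro x
    have e : ∑ b : Bool, klTerm (noisyParity S η hη (Fin.snoc (α := fun _ => Bool) x b)).toReal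
        (Q (Fin.snoc (α := fun _ => Bool) x b)).toReal =
      klTerm ((1 / 2) ^ n * (1 - η)) (Q (Fin.snoc (α := fun _ => Bool) x (parity S x))).toReal +
      klTerm ((1 / 2) ^ n * η) (Q (Fin.snoc (α := fun _ => Bool) x (!parity S x))).toReal := by
      simp only [toReal_noisyParity, Fintype.sum_bool]
      cases parity S x <;> simp [add_comm]
    rw [e]
    split_ifs with hx
    · exact hκ x hx
    -- Correctly predicted points may be dropped because the summand `q - p` in `klTerm` makes each
    -- term nonnegative separately.
    · exact add_nonneg (klTerm_nonneg (by positivity) (hQ _)) (klTerm_nonneg (by positivity) (hQ _))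
  refine le_trans (le_of_eq ?_) (Finset.sum_le_sum fun x _ => key x)
  rw [← Finset.sum_filter, Finset.sum_const, nsmul_eq_mul, errorRate, one_div, inv_pow]
  ring

/-- A pair of probabilities in the wrong order costs at least `1 - H(η)` bits. -/
theorem log_two_sub_binEntropy_le {c η q q' : ℝ} (hc : 0 < c) (hη : η ∈ Set.Ioo (0 : ℝ) (1 / 2))
    (hq : 0 < q) (hqq : q ≤ q') :
    (Real.log 2 - Real.binEntropy η) * c ≤ klTerm (c * (1 - η)) q + klTerm (c * η) q' := by
  have hη0 := hη.1
  have hη1 : 0 < 1 - η := by linarith [hη.2]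
  -- Both tangents are taken at `c / 2`, the optimal common value when the order of the pair is
  -- wrong. Their sum exceeds the claimed bound by `(1 - 2 * η) * (q' - q)`.
  have h1 := klTerm_ge_tangent (mul_pos hc hη1) hq (half_pos hc)
  have h2 := klTerm_ge_tangent (mul_pos hc hη0) (hq.trans_le hqq) (half_pos hc)
  have e1 : Real.log (c * (1 - η) / (c / 2)) = Real.log (1 - η) + Real.log 2 := by
    rw [← Real.log_mul hη1.ne' two_ne_zero]
    congr 1
    field_simp
  have e2 : Real.log (c * η / (c / 2)) = Real.log η + Real.log 2 := by
    rw [← Real.log_mul hη0.ne' two_ne_zero]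
    congr 1
    field_simp
  have e3 : c * (1 - η) * (q / (c / 2)) = 2 * (1 - η) * q := by field_simp
  have e4 : c * η * (q' / (c / 2)) = 2 * η * q' := by field_simp
  rw [e1, e3] at h1
  rw [e2, e4] at h2
  have h3 : 0 ≤ (1 - 2 * η) * (q' - q) :=
    mul_nonneg (by linarith [hη.2]) (sub_nonneg.2 hqq)
  rw [Real.binEntropy, Real.log_inv, Real.log_inv]
  nlinarith

theorem errorRate_le_of_klBits_le {n : ℕ} (S : Finset (Fin n)) (η : ℝ)
    (hη : η ∈ Set.Ioo (0 : ℝ) (1 / 2)) (ε : ℝ) (hε : 0 < ε) (Q : PMF (Fin (n + 1) → Bool))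
    (hQ : klBits (noisyParity S η hη) Q ≤ ENNReal.ofReal (ε * (1 - entropyBits η)))
    (h : (Fin n → Bool) → Bool)
    (hh : ∀ (x : Fin n → Bool) (b : Bool),
      Q (Fin.snoc (α := fun _ => Bool) x (!b)) < Q (Fin.snoc (α := fun _ => Bool) x b) → h x = b) :
    errorRate (parity S) h ≤ ε := by
  have hl : 0 < Real.log 2 := Real.log_pos one_lt_two
  have hpos : 0 < Real.log 2 - Real.binEntropy η :=
    sub_pos.2 (Real.binEntropy_lt_log_two.2 (by linarith [hη.2]))
  rw [klBits, ENNReal.div_le_iff (by simpa using hl) ENNReal.ofReal_ne_top,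
    ← ENNReal.ofReal_mul' hl.le] at hQ
  have hkl := ne_top_of_le_ne_top ENNReal.ofReal_ne_top hQ
  have e : ε * (1 - entropyBits η) * Real.log 2 = (Real.log 2 - Real.binEntropy η) * ε := by
    unfold entropyBits
    field_simp
  rw [e] at hQ
  refine le_of_mul_le_mul_left ((mul_errorRate_le_klDiv hkl h _ fun x hx => ?_).trans
    (ENNReal.toReal_le_of_le_ofReal (by positivity) hQ)) hpos
  refine log_two_sub_binEntropy_le (by positivity) hη
    (ENNReal.toReal_pos (pos_of_klDiv_ne_top hkl (noisyParity_ne_zero S η hη _))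
      (PMF.apply_ne_top _ _)) ?_
  rw [ENNReal.toReal_le_toReal (PMF.apply_ne_top _ _) (PMF.apply_ne_top _ _)]
  -- If the true label were strictly likelier under `Q`, then `h` would predict it. Ties count as
  -- wrong order, which the bound allows.
  by_contra hlt
  exact hx (hh x _ (not_le.1 hlt))

/-! ## The generator of noisy parities -/

/-- A matrix with two nonzero entries in every column, whose columns are interchanged by an
involution of the rows, is unitary. -/
theorem mem_unitaryGroup_of_two_entries {ι : Type*} [Fintype ι] [DecidableEq ι]
    {U : Matrix ι ι ℂ} {φ τ : ι → ι} {α β : ι → ℝ} (hφ : Function.Injective φ)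
    (hτ : Function.Involutive τ) (hne : ∀ i, τ i ≠ i) (hαβ : ∀ i, α i ^ 2 + β i ^ 2 = 1)
    (hc : ∀ c c', φ c = τ (φ c') → α c = α c' ∧ β c = β c')
    (hU : ∀ r c, U r c =
      if r = φ c then (α c : ℂ) else if r = τ (φ c) then Complex.I * (β c : ℂ) else 0) :
    U ∈ Matrix.unitaryGroup ι ℂ := by
  have hU' : ∀ r c, U r c = (if r = φ c then (α c : ℂ) else 0) +
      (if r = τ (φ c) then Complex.I * (β c : ℂ) else 0) := by
    intro r c
    rw [hU]
    by_cases h1 : r = φ c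
    · simp [h1, (hne (φ c)).symm]
    · simp [h1]
  rw [Matrix.mem_unitaryGroup_iff']
  ext c c'
  rw [Matrix.mul_apply]
  simp only [Matrix.star_apply]
  have e : ∀ r, star (U r c) * U r c' =
      (if r = φ c then (α c : ℂ) * U r c' else 0) +
      (if r = τ (φ c) then -(Complex.I * (β c : ℂ)) * U r c' else 0) := by
    intro r
    rw [hU' r c, star_add, add_mul]
    congr 1 <;> split_ifs <;> simp
  rw [Finset.sum_congr rfl fun r _ => e r, Finset.sum_add_distrib]
  simp only [Finset.sum_ite_eq', Finset.mem_univ, if_true]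
  rw [hU' (φ c) c', hU' (τ (φ c)) c', Matrix.one_apply]
  have h1 : φ c = φ c' ↔ c = c' := hφ.eq_iff
  have h2 : τ (φ c) = τ (φ c') ↔ c = c' := hτ.injective.eq_iff.trans h1
  have h3 : τ (φ c) = φ c' ↔ φ c = τ (φ c') :=
    ⟨fun h => by rw [← h, hτ], fun h => by rw [h, hτ]⟩
  simp only [h1, h2, h3]
  by_cases hcc : c = c'
  · subst hcc
    have : φ c ≠ τ (φ c) := (hne _).symm
    simp only [this, if_true, if_false]
    have := hαβ c
    have h4 : (α c : ℂ) ^ 2 + (β c : ℂ) ^ 2 = 1 := by exact_mod_cast this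
    linear_combination h4 - (β c : ℂ) ^ 2 * Complex.I_sq
  · simp only [hcc, if_false]
    -- Since `φ` is injective, distinct columns meet only when their two rows are interchanged. The
    -- inner product is then `α * (iβ) + (-iβ) * α = 0`.
    by_cases h : φ c = τ (φ c')
    · obtain ⟨ha, hb⟩ := hc _ _ h
      simp only [h, if_true, ha, hb]
      ring
    · simp [h]

/-- The effect of one step of a generator with two entries in every column, on a basis state. -/
theorem QuantumGenerator.proj_mulVec_single {ι : Type*} [Fintype ι] [DecidableEq ι]
    (G : QuantumGenerator ι) {c p q : ι} {α β : ℂ}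
    (hU : ∀ r, G.U r c = if r = p then α else if r = q then β else 0)
    (ho : G.outcome q = !G.outcome p) (b : Bool) (z : ℂ) :
    G.proj b (Matrix.mulVec G.U (Pi.single c z)) =
      if G.outcome p = b then Pi.single p (α * z) else Pi.single q (β * z) := by
  have hpq : q ≠ p := by
    rintro rfl
    simp at ho
  ext r
  simp only [proj, Matrix.mulVec_single]
  by_cases h1 : r = p
  · subst h1
    by_cases hb : G.outcome r = b <;> simp [hb, hpq.symm, hU]
  · by_cases h2 : r = q
    · subst h2
      by_cases hb : G.outcome p = b <;> simp [hb, h1, hU, ho]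
    · split_ifs <;> simp [h1, h2, hU]

/-! ### Unitarity of the noisy parity generator. -/

/-- The row of the first nonzero entry of a column of the transition matrix. -/
def parityStep {n : ℕ} (S : Finset (Fin n)) (c : ParityState n) : ParityState n :=
  Fin.lastCases (motive := fun _ => ParityState n) (0, c.2)
    (fun s : Fin n => if s ∉ S ∨ IsMin S s then (s.succ, c.2)
      else (s.succ, xor c.2.1 c.2.2, c.2.1)) c.1

/-- The involution of the rows that interchanges the two nonzero entries of a column. -/
def parityFlip {n : ℕ} (S : Finset (Fin n)) (r : ParityState n) : ParityState n :=
  (r.1, Fin.cases (motive := fun _ => Bool × Bool) (!r.2.1, r.2.2)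
    (fun s : Fin n => if s ∉ S then (r.2.1, !r.2.2) else (!r.2.1, r.2.2)) r.1)

/-- The modulus of the first nonzero entry of a column. -/
noncomputable def parityFst {n : ℕ} (η : ℝ) (c : ParityState n) : ℝ :=
  if c.1 = Fin.last n then Real.sqrt (1 - η) else 1 / Real.sqrt 2

/-- The modulus of the second nonzero entry of a column. -/
noncomputable def paritySnd {n : ℕ} (η : ℝ) (c : ParityState n) : ℝ :=
  if c.1 = Fin.last n then Real.sqrt η else 1 / Real.sqrt 2

theorem parityMatrix_apply {n : ℕ} (S : Finset (Fin n)) (η : ℝ) (r c : ParityState n) :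
    parityMatrix S η r c = if r = parityStep S c then (parityFst η c : ℂ)
      else if r = parityFlip S (parityStep S c) then Complex.I * (paritySnd η c : ℂ) else 0 := by
  obtain ⟨j, k, l⟩ := c
  induction j using Fin.lastCases with
  | last => simp [parityMatrix, parityStep, parityFlip, parityFst, paritySnd]
  | cast s =>
    by_cases h1 : s ∈ S
    · by_cases h2 : IsMin S s
      · simp [parityMatrix, parityStep, parityFlip, parityFst, paritySnd, h1, if_pos h2,
          (Fin.castSucc_lt_last s).ne, div_eq_mul_inv]
      · simp only [parityMatrix, parityStep, parityFlip, parityFst, paritySnd, h1, h2,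
          (Fin.castSucc_lt_last s).ne, Matrix.of_apply, Fin.lastCases_castSucc, not_true,
          if_false, or_self, Fin.cases_succ, div_eq_mul_inv]
        simp
    · simp [parityMatrix, parityStep, parityFlip, parityFst, paritySnd, h1,
        (Fin.castSucc_lt_last s).ne, div_eq_mul_inv]

/-- The first index advances cyclically whatever `k` and `l` are. This gives half of injectivity,
and also shows that columns sharing rows have entries of the same moduli. -/
theorem parityStep_fst_eq {n : ℕ} (S : Finset (Fin n)) {c c' : ParityState n}
    (h : (parityStep S c).1 = (parityStep S c').1) : c.1 = c'.1 := by
  obtain ⟨j, k, l⟩ := c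
  obtain ⟨j', k', l'⟩ := c'
  induction j using Fin.lastCases with
  | last =>
    induction j' using Fin.lastCases with
    | last => rfl
    | cast s' =>
      simp only [parityStep, Fin.lastCases_last, Fin.lastCases_castSucc] at h
      split_ifs at h <;> simp [eq_comm] at h
  | cast s =>
    induction j' using Fin.lastCases with
    | last =>
      simp only [parityStep, Fin.lastCases_last, Fin.lastCases_castSucc] at h
      split_ifs at h <;> simp at h
    | cast s' =>
      simp only [parityStep, Fin.lastCases_castSucc] at h
      split_ifs at h <;> simpa using h

/-- For fixed `j` the pair `(k, l)` is either kept or mapped to `(k ⊕ l, k)`. Storing the old `k` in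
the second slot is what makes the latter map invertible. -/
theorem parityStep_injective {n : ℕ} (S : Finset (Fin n)) :
    Function.Injective (parityStep S) := by
  intro c c' h
  have h1 := parityStep_fst_eq S (congrArg Prod.fst h)
  obtain ⟨j, k, l⟩ := c
  obtain ⟨j', k', l'⟩ := c'
  obtain rfl : j = j' := h1
  induction j using Fin.lastCases with
  | last => simpa [parityStep] using h
  | cast s =>
    simp only [parityStep, Fin.lastCases_castSucc] at h
    split_ifs at h
    · simpa using h
    · revert h
      cases k <;> cases l <;> cases k' <;> cases l' <;> simp

theorem parityFlip_involutive {n : ℕ} (S : Finset (Fin n)) :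
    Function.Involutive (parityFlip S) := by
  rintro ⟨j, k, l⟩
  induction j using Fin.cases with
  | zero => simp [parityFlip]
  | succ s => by_cases h : s ∈ S <;> simp [parityFlip, h]

theorem parityFlip_ne {n : ℕ} (S : Finset (Fin n)) (r : ParityState n) : parityFlip S r ≠ r := by
  obtain ⟨j, k, l⟩ := r
  induction j using Fin.cases with
  | zero => simp [parityFlip]
  | succ s => by_cases h : s ∈ S <;> simp [parityFlip, h]

/-- The bit that is flipped always enters the outcome, so a measurement separates the two rows of a
column. -/
theorem parityOutcome_flip {n : ℕ} (S : Finset (Fin n)) (r : ParityState n) :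
    parityOutcome S (parityFlip S r) = !parityOutcome S r := by
  obtain ⟨j, k, l⟩ := r
  induction j using Fin.cases with
  | zero => simp [parityFlip, parityOutcome]
  | succ s =>
    by_cases h : s ∈ S
    · by_cases h2 : IsMin S s
      · simp [parityFlip, parityOutcome, h, if_pos h2]
      · simp only [parityFlip, parityOutcome, h, h2, Fin.cases_succ, not_true, if_false]
        cases k <;> cases l <;> rfl
    · simp [parityFlip, parityOutcome, h]

theorem parityMatrix_mem_unitaryGroup {n : ℕ} (S : Finset (Fin n)) {η : ℝ}
    (hη : η ∈ Set.Ioo (0 : ℝ) (1 / 2)) :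
    parityMatrix S η ∈ Matrix.unitaryGroup (ParityState n) ℂ := by
  refine mem_unitaryGroup_of_two_entries (parityStep_injective S) (parityFlip_involutive S)
    (parityFlip_ne S) (α := parityFst η) (β := paritySnd η) (fun c => ?_) (fun c c' h => ?_)
    (parityMatrix_apply S η)
  · unfold parityFst paritySnd
    split_ifs
    · rw [Real.sq_sqrt (by linarith [hη.2]), Real.sq_sqrt hη.1.le]
      ring
    · rw [div_pow, Real.sq_sqrt zero_le_two]
      norm_num
  · have := parityStep_fst_eq S (c := c) (c' := c') (by rw [h]; rfl)
    simp [parityFst, paritySnd, this]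

/-- The quantum generator whose output distribution is the distribution of noisy parities. -/
noncomputable def parityGenerator {n : ℕ} (S : Finset (Fin n)) (η : ℝ)
    (hη : η ∈ Set.Ioo (0 : ℝ) (1 / 2)) : QuantumGenerator (ParityState n) where
  init := Pi.single (0, false, false) 1
  init_norm := by
    rw [Finset.sum_eq_single (0, false, false)]
    · simp
    · intro b _ hb
      simp [Pi.single_eq_of_ne hb]
    · simp
  U := parityMatrix S η
  unitary := parityMatrix_mem_unitaryGroup S hη
  outcome := parityOutcome S
  outcome_surjective b := ⟨(0, b, false), by simp [parityOutcome]⟩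

theorem parityGenerator_step {n : ℕ} (S : Finset (Fin n)) (η : ℝ)
    (hη : η ∈ Set.Ioo (0 : ℝ) (1 / 2)) (c : ParityState n) (b : Bool) (z : ℂ) :
    (parityGenerator S η hη).proj b
        (Matrix.mulVec (parityGenerator S η hη).U (Pi.single c z)) =
      if parityOutcome S (parityStep S c) = b
      then Pi.single (parityStep S c) (parityFst η c * z)
      else Pi.single (parityFlip S (parityStep S c)) (Complex.I * paritySnd η c * z) :=
  (parityGenerator S η hη).proj_mulVec_single (parityMatrix_apply S η · c)
    (parityOutcome_flip S _) b z

/-! ### The state after `j` measurements, and the output distribution. -/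

theorem QuantumGenerator.amplitude_concat {ι : Type*} [Fintype ι] [DecidableEq ι]
    (G : QuantumGenerator ι) (x : List Bool) (b : Bool) (v : ι → ℂ) :
    G.amplitude (x ++ [b]) v = G.proj b (Matrix.mulVec G.U (G.amplitude x v)) := by
  simp [amplitude]

theorem parity_insert {n : ℕ} {S : Finset (Fin n)} {s : Fin n} (hs : s ∉ S) (x : Fin n → Bool) :
    parity (insert s S) x = xor (parity S x) (x s) := by
  unfold parity
  rw [Finset.filter_insert]
  cases hx : x s
  · simp
  · simp only [if_true, Bool.xor_true]
    rw [Finset.card_insert_of_notMem (by simp [hs])]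
    simp only [Nat.odd_add_one, decide_not]

/-- Invariant of the run: one basis vector survives each measurement and its squared modulus halves.
The bit `l` may stay unspecified because the update of the parity is correct for either value of it.
-/
theorem amplitude_parityGenerator {n : ℕ} (S : Finset (Fin n)) (η : ℝ)
    (hη : η ∈ Set.Ioo (0 : ℝ) (1 / 2)) (x : Fin n → Bool) (j : ℕ) (hj : j ≤ n) :
    ∃ (l : Bool) (z : ℂ), ‖z‖ ^ 2 = (1 / 2) ^ j ∧
      (parityGenerator S η hη).amplitude ((List.ofFn x).take j)
        (parityGenerator S η hη).init =
        Pi.single (⟨j, by omega⟩, parity (S.filter fun i => i.1 < j) x, l) z := by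
  induction j with
  | zero => exact ⟨false, 1, by simp [QuantumGenerator.amplitude, parityGenerator, parity]⟩
  | succ j ih =>
    obtain ⟨l, z, hz, h⟩ := ih (by omega)
    set s : Fin n := ⟨j, by omega⟩ with hs
    have htake : (List.ofFn x).take (j + 1) = (List.ofFn x).take j ++ [x s] := by
      rw [List.take_add_one, List.getElem?_eq_getElem (by simp; omega)]
      simp [hs]
    have hc : ((⟨j, by omega⟩ : Fin (n + 1))) = s.castSucc := rfl
    have hc' : ((⟨j + 1, by omega⟩ : Fin (n + 1))) = s.succ := rfl
    rw [htake, QuantumGenerator.amplitude_concat, h, parityGenerator_step]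
    rw [hc, hc']
    have hn1 : ‖((parityFst η ((s.castSucc, parity (S.filter fun i => i.1 < j) x, l) :
        ParityState n) : ℝ) : ℂ) * z‖ ^ 2 = (1 / 2) ^ (j + 1) := by
      simp only [parityFst, (Fin.castSucc_lt_last s).ne, if_false]
      rw [norm_mul, mul_pow, hz, Complex.norm_real, Real.norm_eq_abs, sq_abs, div_pow,
        Real.sq_sqrt zero_le_two]
      ring
    have hn2 : ‖Complex.I * ((paritySnd η ((s.castSucc, parity (S.filter fun i => i.1 < j) x, l) :
        ParityState n) : ℝ) : ℂ) * z‖ ^ 2 = (1 / 2) ^ (j + 1) := by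
      simp only [paritySnd, (Fin.castSucc_lt_last s).ne, if_false]
      rw [norm_mul, norm_mul, mul_pow, hz, Complex.norm_I, one_mul, Complex.norm_real,
        Real.norm_eq_abs, sq_abs, div_pow, Real.sq_sqrt zero_le_two]
      ring
    by_cases hS : s ∈ S
    · have hp : parity (S.filter fun i => i.1 < j + 1) x
          = xor (parity (S.filter fun i => i.1 < j) x) (x s) := by
        rw [← parity_insert (by simp [hs])]
        congr 1
        ext i
        simp only [Finset.mem_filter, Finset.mem_insert, Fin.ext_iff, hs]
        constructor
        · rintro ⟨h1, h2⟩
          by_cases h3 : i.1 = j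
          · exact Or.inl h3
          · exact Or.inr ⟨h1, by omega⟩
        · rintro (h1 | ⟨h1, h2⟩)
          · have : i = s := Fin.ext h1
            exact ⟨this ▸ hS, by omega⟩
          · exact ⟨h1, by omega⟩
      rw [hp]
      by_cases hm : IsMin S s
      · have h0 : parity (S.filter fun i => i.1 < j) x = false := by
          have : S.filter (fun i => i.1 < j) = ∅ := by
            rw [Finset.filter_eq_empty_iff]
            intro i hi
            have := hm.2 i hi
            simpa [Fin.le_def, hs] using this
          simp [this, parity]
        rw [h0] at hn1 hn2 ⊢
        have e1 : parityStep S (s.castSucc, false, l) = (s.succ, false, l) := by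
          simp only [parityStep, Fin.lastCases_castSucc, if_pos (Or.inr hm : s ∉ S ∨ IsMin S s)]
        have e2 : parityOutcome S (s.succ, false, l) = false := by
          simp only [parityOutcome, Fin.cases_succ, if_neg (not_not.2 hS), if_pos hm]
        have e3 : parityFlip S (s.succ, false, l) = (s.succ, true, l) := by
          simp [parityFlip, hS]
        rw [e1, e2, e3]
        cases hx : x s
        · exact ⟨l, _, hn1, rfl⟩
        · exact ⟨l, _, hn2, rfl⟩
      · generalize parity (S.filter fun i => i.1 < j) x = k at hn1 hn2 ⊢
        have e1 : parityStep S (s.castSucc, k, l) = (s.succ, xor k l, k) := by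
          simp only [parityStep, Fin.lastCases_castSucc, hS, hm, not_true, or_self, if_false]
        -- The outcome here is `(k ⊕ l) ⊕ k = l`, while the new first bit is `k ⊕ l`. In the flipped
        -- row both are negated, so in both cases the new parity is `k` plus the outcome.
        have e2 : parityOutcome S (s.succ, xor k l, k) = l := by
          simp only [parityOutcome, Fin.cases_succ, hS, hm, not_true, if_false]
          cases k <;> cases l <;> rfl
        have e3 : parityFlip S (s.succ, xor k l, k) = (s.succ, !(xor k l), k) := by
          simp [parityFlip, hS]
        rw [e1, e2, e3]
        split_ifs with hl
        · exact ⟨k, _, hn1, by rw [hl]⟩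
        · have : x s = !l := by revert hl; cases l <;> cases x s <;> simp
          exact ⟨k, _, hn2, by rw [this, Bool.xor_not]⟩
    · have hp : S.filter (fun i => i.1 < j + 1) = S.filter fun i => i.1 < j := by
        ext i
        simp only [Finset.mem_filter, and_congr_right_iff]
        intro hi
        have : i.1 ≠ j := fun h => hS ((Fin.ext h : i = s) ▸ hi)
        omega
      rw [hp]
      generalize parity (S.filter fun i => i.1 < j) x = k at hn1 hn2 ⊢
      have e1 : parityStep S (s.castSucc, k, l) = (s.succ, k, l) := by
        simp [parityStep, hS]
      have e2 : parityOutcome S (s.succ, k, l) = l := by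
        simp [parityOutcome, hS]
      have e3 : parityFlip S (s.succ, k, l) = (s.succ, k, !l) := by
        simp [parityFlip, hS]
      rw [e1, e2, e3]
      split_ifs
      · exact ⟨_, _, hn1, rfl⟩
      · exact ⟨_, _, hn2, rfl⟩

theorem sum_norm_sq_single {ι : Type*} [Fintype ι] [DecidableEq ι] (c : ι) (z : ℂ) :
    ∑ i, ‖(Pi.single c z : ι → ℂ) i‖ ^ 2 = ‖z‖ ^ 2 := by
  rw [Finset.sum_eq_single c]
  · simp
  · intro b _ hb
    simp [Pi.single_eq_of_ne hb]
  · simp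

theorem outputDist_parityGenerator {n : ℕ} (S : Finset (Fin n)) (η : ℝ)
    (hη : η ∈ Set.Ioo (0 : ℝ) (1 / 2)) :
    (parityGenerator S η hη).outputDist (n + 1) = noisyParity S η hη := by
  ext y
  obtain ⟨x, b, rfl⟩ : ∃ (x : Fin n → Bool) (b : Bool), y = Fin.snoc (α := fun _ => Bool) x b :=
    ⟨Fin.init y, y (Fin.last n), (Fin.snoc_init_self (α := fun _ => Bool) y).symm⟩
  rw [noisyParity_snoc, QuantumGenerator.outputDist, PMF.ofFintype_apply]
  congr 1
  obtain ⟨l, z, hz, h⟩ := amplitude_parityGenerator S η hη x n le_rfl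
  have e : List.ofFn (Fin.snoc (α := fun _ => Bool) x b) = List.ofFn x ++ [b] := by
    rw [List.ofFn_succ']
    simp [List.concat_eq_append]
  have hl : ((⟨n, by omega⟩ : Fin (n + 1))) = Fin.last n := rfl
  have hp : S.filter (fun i => i.1 < n) = S := by simp
  rw [List.take_of_length_le (by simp), hl, hp] at h
  rw [QuantumGenerator.outputProb, e, QuantumGenerator.amplitude_concat, h, parityGenerator_step,
    ← hz]
  -- The last step returns to index `0`, where the outcome is `k`, the full parity. The flipped row,
  -- of amplitude `i√η`, supplies the noise.
  have e1 : parityStep S (Fin.last n, parity S x, l) = (0, parity S x, l) := by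
    simp [parityStep]
  have e2 : parityOutcome S (0, parity S x, l) = parity S x := by simp [parityOutcome]
  rw [e1, e2]
  by_cases hb : parity S x = b
  · rw [if_pos hb, if_pos hb.symm, sum_norm_sq_single]
    rw [norm_mul, mul_pow, Complex.norm_real, Real.norm_eq_abs, sq_abs]
    simp only [parityFst, if_true]
    rw [Real.sq_sqrt (by linarith [hη.2])]
    ring
  · rw [if_neg hb, if_neg (Ne.symm hb), sum_norm_sq_single]
    rw [norm_mul, norm_mul, mul_pow, Complex.norm_I, one_mul, Complex.norm_real,
      Real.norm_eq_abs, sq_abs]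
    simp only [paritySnd, if_true]
    rw [Real.sq_sqrt hη.1.le]
    ring

/-! ### Invariance under renaming of the basis states. -/

/-- A quantum generator with its basis states renamed. -/
def QuantumGenerator.reindex {ι κ : Type*} [Fintype ι] [DecidableEq ι] [Fintype κ]
    [DecidableEq κ] (e : ι ≃ κ) (G : QuantumGenerator ι) : QuantumGenerator κ where
  init := G.init ∘ e.symm
  init_norm := by
    rw [← G.init_norm]
    exact e.symm.sum_comp fun i => ‖G.init i‖ ^ 2
  U := G.U.submatrix e.symm e.symm
  unitary := by
    rw [Matrix.mem_unitaryGroup_iff', Matrix.star_eq_conjTranspose,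
      Matrix.conjTranspose_submatrix, Matrix.submatrix_mul_equiv,
      ← Matrix.star_eq_conjTranspose, (Matrix.mem_unitaryGroup_iff').1 G.unitary,
      Matrix.submatrix_one_equiv]
  outcome := G.outcome ∘ e.symm
  outcome_surjective := G.outcome_surjective.comp e.symm.surjective

theorem QuantumGenerator.amplitude_reindex {ι κ : Type*} [Fintype ι] [DecidableEq ι] [Fintype κ]
    [DecidableEq κ] (e : ι ≃ κ) (G : QuantumGenerator ι) (x : List Bool) (v : ι → ℂ) :
    (G.reindex e).amplitude x (v ∘ e.symm) = G.amplitude x v ∘ e.symm := by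
  induction x generalizing v with
  | nil => rfl
  | cons b x ih =>
    have : (G.reindex e).proj b (Matrix.mulVec (G.reindex e).U (v ∘ e.symm))
        = G.proj b (Matrix.mulVec G.U v) ∘ e.symm := by
      ext i
      simp [proj, reindex, Matrix.submatrix_mulVec_equiv, Function.comp_def]
    simp only [amplitude, List.foldl_cons] at ih ⊢
    rw [this, ih]

theorem QuantumGenerator.outputDist_reindex {ι κ : Type*} [Fintype ι] [DecidableEq ι]
    [Fintype κ] [DecidableEq κ] (e : ι ≃ κ) (G : QuantumGenerator ι) (n : ℕ) :
    (G.reindex e).outputDist n = G.outputDist n := by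
  ext x
  rw [outputDist, outputDist, PMF.ofFintype_apply, PMF.ofFintype_apply]
  congr 1
  unfold outputProb
  rw [show (G.reindex e).init = G.init ∘ e.symm from rfl, amplitude_reindex]
  exact e.symm.sum_comp fun i => ‖G.amplitude (List.ofFn x) G.init i‖ ^ 2

theorem card_parityState (n : ℕ) : Fintype.card (ParityState n) = 4 * (n + 1) := by
  simp [ParityState, mul_comm]

/-! ## Thresholding an evaluator -/

/-- The circuit that decides whether the first `m` output bits of `C` are all zero. -/
def Circuit.allZero (C : Circuit) (m : ℕ) : Circuit where
  numOut := 1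
  gates := C.gates ++ (.const false :: (List.replicate m (.or 0 m) ++ [.not 0]))

/-- References are relative, so the fixed offset `m` slides along `w` as gates are added: the first
gate `or 0 m` reads entry `m - 1` of `w`, the next one entry `m - 2`, and so on. Identical gates
thus scan all `m` entries. -/
theorem foldl_or_eval {n : ℕ} (x : Fin n → Bool) (w : List Bool) (m t : ℕ) (ht : t ≤ m) :
    ∃ v : List Bool, v.length = t ∧
      (List.replicate t (Gate.or 0 m)).foldl (fun w g => g.eval x w :: w) (false :: w) =
        decide (∃ j < m, m - t ≤ j ∧ w.getD j false = true) :: (v ++ w) := by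
  induction t with
  | zero =>
    refine ⟨[], rfl, ?_⟩
    have : ¬ ∃ j < m, m - 0 ≤ j ∧ w.getD j false = true := by
      rintro ⟨j, h1, h2, -⟩
      omega
    rw [decide_eq_false this]
    rfl
  | succ t ih =>
    obtain ⟨v, hv, h⟩ := ih (by omega)
    refine ⟨decide (∃ j < m, m - t ≤ j ∧ w.getD j false = true) :: v, by simp [hv], ?_⟩
    rw [List.replicate_succ', List.foldl_append, h]
    simp only [List.foldl_cons, List.foldl_nil, Gate.eval, List.getD_cons_zero, List.cons_append]
    congr 1
    have hm : m = (m - (t + 1)) + v.length + 1 := by omega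
    have e : (decide (∃ j < m, m - t ≤ j ∧ w.getD j false = true) :: (v ++ w)).getD m false
        = w.getD (m - (t + 1)) false := by
      conv_lhs => rw [hm]
      rw [List.getD_cons_succ, List.getD_append_right _ _ _ _ (by omega), Nat.add_sub_cancel]
    rw [e, Bool.eq_iff_iff, Bool.or_eq_true, decide_eq_true_iff, decide_eq_true_iff]
    constructor
    · rintro (⟨j, h1, h2, h3⟩ | h3)
      · exact ⟨j, h1, by omega, h3⟩
      · exact ⟨m - (t + 1), by omega, le_rfl, h3⟩
    · rintro ⟨j, h1, h2, h3⟩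
      by_cases hj : j = m - (t + 1)
      · exact Or.inr (hj ▸ h3)
      · exact Or.inl ⟨j, h1, by omega, h3⟩

theorem Circuit.fn_allZero (C : Circuit) (m : ℕ) {n : ℕ} (x : Fin n → Bool) :
    (C.allZero m).fn x = decide (∀ j < m, (C.wires x).getD j false = false) := by
  obtain ⟨v, -, h⟩ := foldl_or_eval x (C.wires x) m m le_rfl
  have e : (C.allZero m).wires x
      = (!decide (∃ j < m, m - m ≤ j ∧ (C.wires x).getD j false = true)) ::
        decide (∃ j < m, m - m ≤ j ∧ (C.wires x).getD j false = true) :: (v ++ C.wires x) := by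
    rw [wires, allZero, List.foldl_append]
    simp only [List.foldl_cons, List.foldl_append, List.foldl_nil]
    have h' : List.foldl (fun w g => Gate.eval x w g :: w)
      (Gate.eval x (List.foldl (fun w g => Gate.eval x w g :: w) [] C.gates) (Gate.const false) ::
        List.foldl (fun w g => Gate.eval x w g :: w) [] C.gates)
      (List.replicate m (Gate.or 0 m)) = _ := h
    rw [h']
    rfl
  rw [fn, out, e, List.getD_cons_zero]
  rw [← decide_not]
  simp [allZero]

/-- A missing input reads `false`. Running the evaluator on only `n` bits therefore hardwires the
label `false` without changing any gate. -/
theorem Circuit.wires_snoc_false (C : Circuit) {n : ℕ} (x : Fin n → Bool) :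
    C.wires (Fin.snoc (α := fun _ => Bool) x false) = C.wires x := by
  unfold wires
  congr 1
  funext w g
  congr 1
  cases g with
  | input i =>
    simp only [Gate.eval]
    rcases lt_trichotomy i n with h | h | h
    · rw [dif_pos (by omega), dif_pos h]
      exact Fin.snoc_castSucc (α := fun _ => Bool) false x ⟨i, h⟩
    · subst h
      rw [dif_pos (by omega), dif_neg (by omega)]
      exact Fin.snoc_last (α := fun _ => Bool) false x
    · rw [dif_neg (by omega), dif_neg (by omega)]
  | _ => rfl

theorem sum_half_pow_lt (b : ℕ → Bool) (N M : ℕ) (h : ∀ i < M, i < N + 1 → b i = false) :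
    ∑ i ∈ Finset.range M, (if b i then (1 / 2 : ℝ) ^ i else 0) < (1 / 2) ^ N := by
  rcases le_total M (N + 1) with hM | hM
  · rw [Finset.sum_eq_zero]
    · positivity
    · intro i hi
      rw [Finset.mem_range] at hi
      simp [h i hi (by omega)]
  · obtain ⟨d, rfl⟩ := Nat.exists_eq_add_of_le hM
    -- Finite geometric tail; the remainder `(1 / 2) ^ (N + e)` is what makes the final inequality
    -- strict.
    have key : ∀ e ≤ d, ∑ i ∈ Finset.range (N + 1 + e), (if b i then (1 / 2 : ℝ) ^ i else 0)
        ≤ (1 / 2) ^ N - (1 / 2) ^ (N + e) := by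
      intro e he
      induction e with
      | zero =>
        rw [Finset.sum_eq_zero]
        · simp
        · intro i hi
          rw [Finset.mem_range] at hi
          simp [h i (by omega) (by omega)]
      | succ e ih =>
        rw [← add_assoc, Finset.sum_range_succ]
        have h1 := ih (by omega)
        have h2 : (if b (N + 1 + e) then (1 / 2 : ℝ) ^ (N + 1 + e) else 0)
            ≤ (1 / 2) ^ (N + 1 + e) := by
          split_ifs
          · exact le_rfl
          · positivity
        have h3 : (1 / 2 : ℝ) ^ (N + 1 + e) = (1 / 2) ^ (N + e) / 2 := by ring
        have h4 : (1 / 2 : ℝ) ^ (N + e + 1) = (1 / 2) ^ (N + e) / 2 := by ring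
        rw [← add_assoc]
        linarith
    have h1 := key d le_rfl
    have h2 : (0 : ℝ) < (1 / 2) ^ (N + d) := by positivity
    linarith

/-- Whether the number computed by a circuit is at least `2⁻ᴺ` can be read off the first `N + 1`
output bits. -/
theorem Circuit.value_lt_iff (C : Circuit) (N : ℕ) {n : ℕ} (x : Fin n → Bool) :
    C.value x < (1 / 2) ^ N ↔
      ∀ j < min C.numOut (N + 1), (C.wires x).getD j false = false := by
  constructor
  · intro h j hj
    rw [lt_min_iff] at hj
    by_contra hb
    rw [Bool.not_eq_false] at hb
    refine h.not_ge ?_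
    have hle : (1 / 2 : ℝ) ^ N ≤ if C.out x j then (1 / 2 : ℝ) ^ j else 0 := by
      rw [if_pos (by simp only [out, hj.1, hb, decide_true, Bool.and_true])]
      exact pow_le_pow_of_le_one (by norm_num) (by norm_num) (by omega)
    refine hle.trans (Finset.single_le_sum (f := fun i => if C.out x i then (1 / 2 : ℝ) ^ i else 0)
      (fun i _ => ?_) (Finset.mem_range.2 hj.1))
    split_ifs <;> positivity
  · intro h
    refine sum_half_pow_lt (C.out x) N C.numOut fun i hi hi' => ?_
    simp only [out, h i (lt_min hi hi'), Bool.and_false]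

/-- The circuit that predicts the label `false` if the evaluator `C` gives the example labelled
`false` at least half the uniform probability. -/
def Circuit.predictor (C : Circuit) (n : ℕ) : Circuit := C.allZero (min C.numOut (n + 2))

theorem Circuit.fn_predictor (C : Circuit) {n : ℕ} (x : Fin n → Bool) :
    (C.predictor n).fn x = true ↔
      C.value (Fin.snoc (α := fun _ => Bool) x false) < (1 / 2) ^ (n + 1) := by
  rw [value_lt_iff, wires_snoc_false, predictor, fn_allZero, decide_eq_true_iff]

/-- The true mass of `(x, 0)` is `(1 - η) / 2 ^ n` or `η / 2 ^ n`, strictly on one side of the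
threshold `1 / 2 ^ (n + 1)`. A mistake puts `Q (x, 0)` on the other side or on the threshold, and
moving it to the threshold only lowers the cost. The factor `m` depends on `η` alone. -/
theorem exists_errorRate_predictor_lt (η : ℝ) (hη : η ∈ Set.Ioo (0 : ℝ) (1 / 2)) :
    ∃ m : ℕ, 1 ≤ m ∧ ∀ (n : ℕ) (S : Finset (Fin n)) (a : ℕ) (C : Circuit), 1 ≤ a →
      IsEvaluator (noisyParity S η hη) (1 / ((m * a : ℕ) : ℝ)) C →
      errorRate (parity S) (C.predictor n).fn < 1 / (a : ℝ) := by
  have hη0 := hη.1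
  have hη1 : 0 < 1 - η := by linarith [hη.2]
  have hl : 0 < Real.log 2 := Real.log_pos one_lt_two
  obtain ⟨κ, hκ, hκ1, hκ2⟩ : ∃ κ > 0, κ ≤ klTerm (1 - η) (1 / 2) ∧ κ ≤ klTerm η (1 / 2) :=
    ⟨_, lt_min (klTerm_pos hη1 one_half_pos (by linarith [hη.2]))
      (klTerm_pos hη0 one_half_pos hη.2.ne), min_le_left _ _, min_le_right _ _⟩
  -- A divergence below `1 / (m * a)` bits is below `log 2 / (m * a) ≤ κ / a` nats.
  obtain ⟨m, hm⟩ := exists_nat_ge (Real.log 2 / κ)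
  have hm0 : 0 < m := by
    have : (0 : ℝ) < m := (by positivity : 0 < Real.log 2 / κ).trans_le hm
    exact_mod_cast this
  refine ⟨m, hm0, fun n S a C ha hC => ?_⟩
  obtain ⟨Q, hQC, hQ⟩ := hC
  have ha' : (0 : ℝ) < a := by exact_mod_cast ha
  have hm' : (0 : ℝ) < m := by exact_mod_cast hm0
  rw [klBits, ENNReal.div_lt_iff (Or.inl (by simpa using hl)) (Or.inl ENNReal.ofReal_ne_top),
    ← ENNReal.ofReal_mul' hl.le] at hQ
  have hkl := hQ.ne_top
  have hQ' := ENNReal.toReal_lt_of_lt_ofReal hQ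
  have hQpos : ∀ z, 0 < (Q z).toReal := fun z =>
    ENNReal.toReal_pos (pos_of_klDiv_ne_top hkl (noisyParity_ne_zero S η hη z))
      (PMF.apply_ne_top _ _)
  have hv : ∀ z, (Q z).toReal = C.value z := fun z => by
    rw [hQC, ENNReal.toReal_ofReal]
    exact Finset.sum_nonneg fun i _ => by split_ifs <;> positivity
  have key := mul_errorRate_le_klDiv hkl (C.predictor n).fn κ fun x hx => by
    have hc : (0 : ℝ) < (1 / 2) ^ n := by positivity
    have hp : (1 / 2 : ℝ) ^ (n + 1) = (1 / 2) ^ n * (1 / 2) := pow_succ _ _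
    have hf := C.fn_predictor x
    rw [← hv, hp] at hf
    cases hS : parity S x with
    | false =>
      have hlt := hf.1 (by simpa [hS] using hx)
      have h1 := klTerm_le_of_between (p := (1 / 2) ^ n * (1 - η)) (r := (1 / 2) ^ n * (1 / 2))
        (by positivity) (hQpos (Fin.snoc (α := fun _ => Bool) x false)) (by positivity)
        (mul_nonneg_of_nonpos_of_nonpos (by linarith) (by nlinarith [hη.2]))
      rw [klTerm_mul hc] at h1
      have h2 : 0 ≤ klTerm ((1 / 2) ^ n * η) (Q (Fin.snoc (α := fun _ => Bool) x (!false))).toReal :=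
        klTerm_nonneg (by positivity) (hQpos _)
      nlinarith
    | true =>
      have hlt : ¬ _ := fun h => absurd (hf.2 h) (by simpa [hS] using hx)
      rw [not_lt] at hlt
      have h1 := klTerm_le_of_between (p := (1 / 2) ^ n * η) (r := (1 / 2) ^ n * (1 / 2))
        (by positivity) (hQpos (Fin.snoc (α := fun _ => Bool) x false)) (by positivity)
        (mul_nonneg (by linarith) (by nlinarith [hη.2]))
      rw [klTerm_mul hc] at h1
      have h2 : 0 ≤ klTerm ((1 / 2) ^ n * (1 - η))
          (Q (Fin.snoc (α := fun _ => Bool) x true)).toReal :=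
        klTerm_nonneg (by positivity) (hQpos _)
      rw [Bool.not_true]
      nlinarith
  have h1 : κ * errorRate (parity S) (C.predictor n).fn < 1 / ((m * a : ℕ) : ℝ) * Real.log 2 :=
    key.trans_lt hQ'
  rw [div_le_iff₀ hκ] at hm
  have h2 : 1 / ((m * a : ℕ) : ℝ) * Real.log 2 ≤ κ * (1 / a) := by
    push_cast
    rw [one_div_mul_eq_div, div_le_iff₀ (by positivity)]
    field_simp
    linarith
  exact lt_of_mul_lt_mul_left (h1.trans_le h2) hκ.le

/-! ## Running times of simple programs -/

theorem Config.ext_stack {c d : Config} (h : ∀ s, c.stack s = d.stack s) (h1 : c.drawn = d.drawn)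
    (h2 : c.tossed = d.tossed) : c = d := by
  obtain ⟨s, i, j⟩ := c
  obtain ⟨s', i', j'⟩ := d
  obtain rfl : s = s' := funext h
  simp_all

theorem Config.stack_set (c : Config) (r : ℕ) (l : List Bool) (s : ℕ) :
    (c.set r l).stack s = if s = r then l else c.stack s := by
  simp [set, Function.update_apply]

/-- `P`, started in `c`, halts after at most `T` steps in `d`. -/
def RunsIn (ex : ℕ → List Bool) (coin : ℕ → Bool) (P : Prog) (c : Config) (T : ℕ) (d : Config) :
    Prop :=
  ∃ t ≤ T, Runs ex coin P c t d

section Programs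

variable {ex : ℕ → List Bool} {coin : ℕ → Bool}

theorem Runs.runsIn {P : Prog} {c d : Config} {t : ℕ} (h : Runs ex coin P c t d) :
    RunsIn ex coin P c t d := ⟨t, le_rfl, h⟩

theorem RunsIn.of {P : Prog} {c d d' : Config} {T U : ℕ} (h : RunsIn ex coin P c T d)
    (hTU : T ≤ U) (hd : d = d') : RunsIn ex coin P c U d' :=
  let ⟨t, ht, hr⟩ := h
  ⟨t, ht.trans hTU, hd ▸ hr⟩

theorem RunsIn.seq {P Q : Prog} {c d e : Config} {T U : ℕ} (h : RunsIn ex coin P c T d)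
    (h' : RunsIn ex coin Q d U e) : RunsIn ex coin (.seq P Q) c (T + U) e :=
  let ⟨_, ht, hr⟩ := h
  let ⟨_, ht', hr'⟩ := h'
  ⟨_, Nat.add_le_add ht ht', .seq hr hr'⟩

theorem RunsIn.loop_step {P : Prog} {r : ℕ} {c d e : Config} {T U : ℕ} (hr : c.stack r ≠ [])
    (h : RunsIn ex coin P c T d) (h' : RunsIn ex coin (.loop r P) d U e) :
    RunsIn ex coin (.loop r P) c (1 + T + U) e :=
  let ⟨_, ht, h1⟩ := h
  let ⟨_, ht', h2⟩ := h'
  ⟨_, by omega, .loop_step hr h1 h2⟩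

/-- Push bits on a stack, so that the first one gets on top. -/
def pushBits (r : ℕ) : List Bool → Prog
  | [] => .skip
  | b :: l => .seq (pushBits r l) (.push r b)

theorem runsIn_pushBits (r : ℕ) (l : List Bool) (c : Config) :
    RunsIn ex coin (pushBits r l) c (l.length + 1) (c.set r (l ++ c.stack r)) := by
  induction l with
  | nil =>
    have : c.set r ([] ++ c.stack r) = c := by simp [Config.set]
    rw [this]
    exact (Runs.skip c).runsIn
  | cons b l ih =>
    refine (ih.seq (Runs.push _ r b).runsIn).of (by simp) ?_
    refine Config.ext_stack (fun s => ?_) rfl rfl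
    by_cases hs : s = r <;> simp [Config.stack_set, hs]

/-- Push `true` on each of the stacks `W`. -/
def pushTrues : List ℕ → Prog
  | [] => .skip
  | s :: W => .seq (.push s true) (pushTrues W)

/-- The effect of pushing `true` on each of the stacks `W`, `k` times. -/
def Config.addTrues (c : Config) (k : ℕ) (W : List ℕ) : Config :=
  { c with stack := fun s => List.replicate (k * W.count s) true ++ c.stack s }

theorem runsIn_pushTrues (W : List ℕ) (c : Config) :
    RunsIn ex coin (pushTrues W) c (W.length + 1) (c.addTrues 1 W) := by
  induction W generalizing c with
  | nil =>
    have : c.addTrues 1 [] = c := by simp [Config.addTrues]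
    rw [this]
    exact (Runs.skip c).runsIn
  | cons r W ih =>
    refine ((Runs.push c r true).runsIn.seq (ih _)).of (by simp; omega) ?_
    refine Config.ext_stack (fun s => ?_) rfl rfl
    by_cases hs : s = r
    · subst hs
      simp [Config.addTrues, Config.stack_set, List.replicate_succ']
    · simp [Config.addTrues, Config.stack_set, hs, List.count_cons_of_ne (Ne.symm hs)]

/-- Empty a stack, pushing `true` on each of the stacks `W` for every bit removed. -/
def pour (r : ℕ) (W : List ℕ) : Prog := .loop r (.seq (.pop r) (pushTrues W))

theorem runsIn_pour {r : ℕ} {W : List ℕ} (hr : r ∉ W) (c : Config) :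
    RunsIn ex coin (pour r W) c ((c.stack r).length * (W.length + 3) + 1)
      ((c.set r []).addTrues (c.stack r).length W) := by
  induction h : c.stack r generalizing c with
  | nil =>
    have : (c.set r []).addTrues ([] : List Bool).length W = c := by
      refine Config.ext_stack (fun s => ?_) rfl rfl
      by_cases hs : s = r <;> simp [Config.addTrues, Config.stack_set, hs, h]
    rw [this]
    exact (Runs.loop_done h).runsIn.of (by omega) rfl
  | cons b l ih =>
    have h1 : (((c.set r (c.stack r).tail).addTrues 1 W).stack r) = l := by
      simp [Config.addTrues, Config.stack_set, h, List.count_eq_zero_of_not_mem hr]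
    refine (RunsIn.loop_step (by simp [h]) ((Runs.pop c r).runsIn.seq (runsIn_pushTrues W _))
      (ih _ h1)).of ?_ ?_
    · simp only [List.length_cons]
      ring_nf
      omega
    · refine Config.ext_stack (fun s => ?_) rfl rfl
      by_cases hs : s = r
      · simp [Config.addTrues, Config.stack_set, hs, List.count_eq_zero_of_not_mem hr]
      · simp only [Config.addTrues, Config.stack_set, hs, if_false, List.length_cons, one_mul]
        rw [← List.append_assoc, List.replicate_append_replicate, add_mul, one_mul]

/-- Move the contents of a stack to another one, in reversed order. -/
def moveRev (r s : ℕ) : Prog :=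
  .loop r (.branch r (.seq (.pop r) (.push s true)) (.seq (.pop r) (.push s false)) .skip)

theorem runsIn_moveRev {r s : ℕ} (hrs : r ≠ s) (c : Config) :
    RunsIn ex coin (moveRev r s) c ((c.stack r).length * 4 + 1)
      ((c.set r []).set s ((c.stack r).reverse ++ c.stack s)) := by
  induction h : c.stack r generalizing c with
  | nil =>
    have : (c.set r []).set s (([] : List Bool).reverse ++ c.stack s) = c := by
      refine Config.ext_stack (fun q => ?_) rfl rfl
      by_cases hq : q = r <;> by_cases hq' : q = s <;> simp_all [Config.stack_set]
    rw [this]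
    exact (Runs.loop_done h).runsIn.of (by omega) rfl
  | cons b l ih =>
    have body : RunsIn ex coin
        (.branch r (.seq (.pop r) (.push s true)) (.seq (.pop r) (.push s false)) .skip) c 3
        ((c.set r l).set s (b :: c.stack s)) := by
      have e : (c.set r l).set s (b :: c.stack s) = (c.set r (c.stack r).tail).set s
          (b :: (c.set r (c.stack r).tail).stack s) := by
        simp [h, Config.stack_set, hrs.symm]
      rw [e]
      cases b
      · exact (Runs.branch_false (by simp [h]) (.seq (.pop c r) (.push _ s false))).runsIn
      · exact (Runs.branch_true (by simp [h]) (.seq (.pop c r) (.push _ s true))).runsIn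
    have h1 : ((c.set r l).set s (b :: c.stack s)).stack r = l := by
      simp [Config.stack_set, hrs]
    refine (RunsIn.loop_step (by simp [h]) body (ih _ h1)).of ?_ ?_
    · simp only [List.length_cons]
      omega
    · refine Config.ext_stack (fun q => ?_) rfl rfl
      by_cases hq : q = r <;> by_cases hq' : q = s <;> simp_all [Config.stack_set]

/-- A stack grows by at most `K` bits in each step. -/
theorem Runs.length_stack_le {K : ℕ} (hK : ∀ i, (ex i).length ≤ K) (hK1 : 1 ≤ K) {P : Prog}
    {c d : Config} {t : ℕ} (h : Runs ex coin P c t d) (r : ℕ) :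
    (d.stack r).length ≤ (c.stack r).length + t * K := by
  induction h with
  | skip => omega
  | push c s b | toss c s =>
    simp only [Config.stack_set]
    split_ifs with h
    · subst h; simp; omega
    · omega
  | pop c s =>
    simp only [Config.stack_set]
    split_ifs with h
    · subst h; simp; omega
    · omega
  | draw c s =>
    have := hK c.drawn
    simp only [Config.stack_set]
    split_ifs with h
    · subst h; simp; omega
    · omega
  | seq _ _ ih1 ih2 => rw [add_mul]; omega
  | branch_true _ _ ih | branch_false _ _ ih | branch_empty _ _ ih => rw [add_mul]; omega
  | loop_done => omega
  | loop_step _ _ _ ih1 ih2 => rw [add_mul, add_mul]; omega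

/-! ## Preparing the arguments for the learner of generators -/

/-- Turn the arguments `n`, `a`, `b` into `n + 1`, `4 (n + 1)`, `m a`, `b`. -/
def prepare (m : ℕ) : Prog :=
  .seq (moveRev 2 4) <| .seq (moveRev 4 3) <| .seq (pour 1 (List.replicate m 2)) <|
    .seq (pour 0 [1, 1, 1, 1, 4]) <| .seq (pour 4 [0]) (pushTrues [0, 1, 1, 1, 1])

/-- The final configuration is exactly a `start` configuration, with no example or coin used, so a
run of the learner can be appended as it stands. Moving `b` twice restores the order of its bits. -/
theorem runsIn_prepare (m n a : ℕ) (l : List Bool) :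
    RunsIn ex coin (prepare m) (start [List.replicate n true, List.replicate a true, l])
      (8 * l.length + a * (m + 3) + 12 * n + 20)
      (start [List.replicate (n + 1) true, List.replicate (4 * (n + 1)) true,
        List.replicate (m * a) true, l]) := by
  refine ((runsIn_moveRev (by norm_num) _).seq <| (runsIn_moveRev (by norm_num) _).seq <|
    (runsIn_pour (by simp [List.mem_replicate]) _).seq <| (runsIn_pour (by simp) _).seq <|
    (runsIn_pour (by simp) _).seq (runsIn_pushTrues _ _)).of ?_ ?_
  · simp [Config.stack_set, Config.addTrues, start, List.count_replicate]
    omega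
  · refine Config.ext_stack (fun s => ?_) rfl rfl
    rcases s with _ | _ | _ | _ | _ | s <;>
      simp [Config.stack_set, Config.addTrues, start, List.count_replicate,
        List.replicate_succ]
    · rw [show 4 * (n + 1) = n * 4 + 1 + 1 + 1 + 1 by ring]
      simp only [List.replicate_succ]
    · exact mul_comm _ _

end Programs

/-! ## Turning an evaluator into a predictor -/

section Programs

variable {ex : ℕ → List Bool} {coin : ℕ → Bool}

/-- Remove a number in unary code from the stack `0`, and push the minimum of this number and the
length of the stack `1` in unary on the stack `2`. -/
def readUnary : Prog :=
  .loop 3 (.branch 0 (.seq (.pop 0) (.branch 1 (.seq (.pop 1) (.push 2 true))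
    (.seq (.pop 1) (.push 2 true)) .skip)) (.seq (.pop 0) (.pop 3)) (.pop 3))

/-- Stack `3` is a flag that keeps the loop alive until the terminating `false`, or the bottom of
stack `0`, is met. Stack `1` is a counter whose exhaustion truncates the number to the minimum. -/
theorem runsIn_readUnary (c : Config) (h3 : c.stack 3 = [true]) :
    RunsIn ex coin readUnary c (6 * (c.stack 0).length + 5)
      ((((c.set 0 ((c.stack 0).dropWhile id).tail).set 1
        ((c.stack 1).drop ((c.stack 0).takeWhile id).length)).set 2
        (List.replicate (min ((c.stack 0).takeWhile id).length (c.stack 1).length) true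
          ++ c.stack 2)).set 3 []) := by
  have hne : c.stack 3 ≠ [] := by simp [h3]
  induction h : c.stack 0 generalizing c with
  | nil =>
    refine (RunsIn.loop_step hne (Runs.branch_empty (by simp [h]) (.pop c 3)).runsIn
      (Runs.loop_done (by simp [Config.stack_set, h3])).runsIn).of (by simp) ?_
    refine Config.ext_stack (fun s => ?_) rfl rfl
    simp only [Config.stack_set]
    split_ifs <;> simp_all
  | cons b l ih =>
    cases b with
    | false =>
      refine (RunsIn.loop_step hne
        (Runs.branch_false (by simp [h]) (.seq (.pop c 0) (.pop _ 3))).runsIn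
        (Runs.loop_done (by simp [Config.stack_set, h3])).runsIn).of (by simp) ?_
      refine Config.ext_stack (fun s => ?_) rfl rfl
      simp only [Config.stack_set]
      split_ifs <;> simp_all
    | true =>
      have inner : RunsIn ex coin (.branch 1 (.seq (.pop 1) (.push 2 true))
          (.seq (.pop 1) (.push 2 true)) .skip) (c.set 0 l) 3
          (((c.set 0 l).set 1 (c.stack 1).tail).set 2
            (List.replicate (min 1 (c.stack 1).length) true ++ c.stack 2)) := by
        cases h1 : c.stack 1 with
        | nil =>
          refine (Runs.branch_empty (by simp [Config.stack_set, h1]) (.skip _)).runsIn.of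
            (by simp) ?_
          refine Config.ext_stack (fun s => ?_) rfl rfl
          simp only [Config.stack_set]
          split_ifs <;> simp_all
        | cons b' l' =>
          have hrun : RunsIn ex coin (.seq (.pop 1) (.push 2 true)) (c.set 0 l) 2
              (((c.set 0 l).set 1 l').set 2 (true :: c.stack 2)) := by
            refine (Runs.seq (.pop _ 1) (.push _ 2 true)).runsIn.of le_rfl ?_
            simp [Config.stack_set, h1]
          obtain ⟨t, ht, hr⟩ := hrun
          have e : List.replicate (min 1 (b' :: l').length) true ++ c.stack 2
              = true :: c.stack 2 := by simp
          rw [e]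
          cases b'
          · exact ⟨1 + t, by omega, .branch_false (by simp [Config.stack_set, h1]) hr⟩
          · exact ⟨1 + t, by omega, .branch_true (by simp [Config.stack_set, h1]) hr⟩
      have body : RunsIn ex coin (.branch 0 (.seq (.pop 0) (.branch 1 (.seq (.pop 1) (.push 2 true))
          (.seq (.pop 1) (.push 2 true)) .skip)) (.seq (.pop 0) (.pop 3)) (.pop 3)) c 5
          (((c.set 0 l).set 1 (c.stack 1).tail).set 2
            (List.replicate (min 1 (c.stack 1).length) true ++ c.stack 2)) := by
        obtain ⟨t, ht, hr⟩ := inner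
        have hp := Runs.pop (ex := ex) (coin := coin) c 0
        rw [h, List.tail_cons] at hp
        exact ⟨_, by omega, .branch_true (by simp [h]) (.seq hp hr)⟩
      refine (RunsIn.loop_step hne body (ih _ (by simpa [Config.stack_set] using h3)
        (by simp [Config.stack_set, h3]) (by simp [Config.stack_set]))).of
        (by simp only [List.length_cons]; omega) ?_
      refine Config.ext_stack (fun s => ?_) rfl rfl
      simp only [Config.stack_set]
      by_cases h2 : s = 2
      · subst h2
        cases h1 : c.stack 1 with
        | nil => simp
        | cons b' l' =>
          simp only [if_true, if_neg (by norm_num : (2 : ℕ) ≠ 3), if_neg (by norm_num : (1 : ℕ) ≠ 2),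
            List.takeWhile_cons, id, List.length_cons, List.tail_cons, ← List.append_assoc,
            List.replicate_append_replicate]
          congr 2
          omega
      · split_ifs <;> simp_all

/-- Push the description of as many gates `or 0 m` on the stack `0` as there are bits on the stack
`3`, if `m` bits `true` are on the stack `5`. -/
def writeOrs : Prog :=
  .loop 3 (.seq (.pop 3) (.seq (pushBits 0 [false]) (.seq (pour 5 [0, 6]) (.seq (pour 6 [5])
    (pushBits 0 [true, true, true, false])))))

theorem runsIn_writeOrs (m k : ℕ) (c : Config) (h3 : c.stack 3 = List.replicate k true)
    (h5 : c.stack 5 = List.replicate m true) (h6 : c.stack 6 = []) :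
    RunsIn ex coin writeOrs c (k * (9 * m + 11) + 1)
      ((c.set 3 []).set 0
        ((List.replicate k (Gate.or 0 m)).flatMap Gate.encode ++ c.stack 0)) := by
  induction k generalizing c with
  | zero =>
    refine (Runs.loop_done h3).runsIn.of (by omega) ?_
    refine Config.ext_stack (fun s => ?_) rfl rfl
    simp only [Config.stack_set]
    split_ifs <;> simp_all
  | succ k ih =>
    -- The description is written from its end. Pouring stack `5` onto `0` and `6` and then `6` back
    -- onto `5` copies `m` while preserving it.
    have body : RunsIn ex coin (.seq (.pop 3) (.seq (pushBits 0 [false])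
        (.seq (pour 5 [0, 6]) (.seq (pour 6 [5]) (pushBits 0 [true, true, true, false])))))
        c (9 * m + 10)
        ((c.set 3 (List.replicate k true)).set 0 ((Gate.or 0 m).encode ++ c.stack 0)) := by
      refine ((Runs.pop c 3).runsIn.seq <| (runsIn_pushBits 0 _ _).seq <|
        (runsIn_pour (by simp) _).seq <| (runsIn_pour (by simp) _).seq
        (runsIn_pushBits 0 _ _)).of ?_ ?_
      · simp [Config.stack_set, Config.addTrues, h5, h6]
        omega
      · refine Config.ext_stack (fun s => ?_) rfl rfl
        by_cases e0 : s = 0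
        · simp [Config.stack_set, Config.addTrues, h3, h5, h6, e0, Gate.encode, unary]
        · by_cases e3 : s = 3
          · simp [Config.stack_set, Config.addTrues, h3, h5, h6, e3]
          · by_cases e5 : s = 5
            · simp [Config.stack_set, Config.addTrues, h3, h5, h6, e5]
            · by_cases e6 : s = 6
              · simp [Config.stack_set, Config.addTrues, h3, h5, h6, e6]
              · simp [Config.stack_set, Config.addTrues, e0, e3, e5, e6, Ne.symm e0, Ne.symm e5,
                  Ne.symm e6]
    refine (RunsIn.loop_step (by simp [h3, List.replicate_succ]) body
      (ih _ (by simp [Config.stack_set]) (by simpa [Config.stack_set] using h5)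
        (by simpa [Config.stack_set] using h6))).of ?_ ?_
    · have : (k + 1) * (9 * m + 11) = k * (9 * m + 11) + (9 * m + 11) := Nat.succ_mul _ _
      omega
    · refine Config.ext_stack (fun s => ?_) rfl rfl
      simp only [Config.stack_set]
      by_cases e0 : s = 0
      · subst e0
        simp only [if_true, List.replicate_succ', List.flatMap_append, List.append_assoc]
        simp
      · split_ifs <;> simp_all

/-- Empty the stacks `1` to `6`. -/
def clearStacks : Prog :=
  .seq (pour 1 []) <| .seq (pour 2 []) <| .seq (pour 3 []) <| .seq (pour 4 []) <|
    .seq (pour 5 []) (pour 6 [])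

/-- Replace the description of an evaluator `C` on the stack `0` by that of `C.predictor n`, when
examples have `n + 1` bits. -/
def makePredictor : Prog :=
  .seq clearStacks <| .seq (.seq (.draw 1) (pushTrues [1, 3])) <| .seq readUnary <|
    .seq (moveRev 0 4) <| .seq (pushBits 0 (Gate.not 0).encode) <| .seq (pour 2 [3, 5]) <|
    .seq writeOrs <| .seq (pushBits 0 (Gate.const false).encode) <|
    .seq (moveRev 4 0) (pushBits 0 (unary 1))

/-- The old gates are parked reversed on stack `4` while the new final gates are written beneath
them. Of the `32 * L` steps, `18 * L` pay for clearing six stacks, `6 * L` for reading the header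
and `8 * L` for the two moves. -/
theorem runsIn_makePredictor {n L : ℕ} (hex : ∀ i, (ex i).length = n + 1) (c : Config)
    (hc : ∀ r, (c.stack r).length ≤ L) :
    ∃ d, RunsIn ex coin makePredictor c (32 * L + (n + 2) * (9 * n + 34) + 40) d ∧
      d.stack 0 = unary 1 ++ (((c.stack 0).dropWhile id).tail ++
        ((Gate.const false).encode ++
        ((List.replicate (min ((c.stack 0).takeWhile id).length (n + 2))
          (Gate.or 0 (min ((c.stack 0).takeWhile id).length (n + 2)))).flatMap Gate.encode ++
        (Gate.not 0).encode))) := by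
  obtain ⟨d₁, hd₁, h0, h1, h2, h3, h4, h5, h6⟩ : ∃ d, RunsIn ex coin clearStacks c (18 * L + 6) d ∧
      d.stack 0 = c.stack 0 ∧ d.stack 1 = [] ∧ d.stack 2 = [] ∧ d.stack 3 = [] ∧
      d.stack 4 = [] ∧ d.stack 5 = [] ∧ d.stack 6 = [] := by
    refine ⟨_, ((runsIn_pour (by simp) _).seq <| (runsIn_pour (by simp) _).seq <|
      (runsIn_pour (by simp) _).seq <| (runsIn_pour (by simp) _).seq <|
      (runsIn_pour (by simp) _).seq (runsIn_pour (by simp) _)).of ?_ rfl, ?_⟩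
    · simp only [Config.stack_set, Config.addTrues]
      have := hc 1
      have := hc 2
      have := hc 3
      have := hc 4
      have := hc 5
      have := hc 6
      simp
      omega
    · simp [Config.stack_set, Config.addTrues]
  -- The learner need not have kept `n`; a fresh example has `n + 1` bits, and one further bit gives
  -- the counter `n + 2`. Only the length of the example is used.
  obtain ⟨d₂, hd₂, g0, g1, g2, g3, g4, g5, g6⟩ : ∃ d, RunsIn ex coin
      (.seq (.draw 1) (pushTrues [1, 3])) d₁ 4 d ∧
      d.stack 0 = c.stack 0 ∧ (d.stack 1).length = n + 2 ∧ d.stack 2 = [] ∧ d.stack 3 = [true] ∧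
      d.stack 4 = [] ∧ d.stack 5 = [] ∧ d.stack 6 = [] := by
    refine ⟨_, ((Runs.draw d₁ 1).runsIn.seq (runsIn_pushTrues _ _)).of (by simp) rfl, ?_⟩
    simp [Config.stack_set, Config.addTrues, h0, h1, h2, h3, h4, h5, h6, hex]
  set m := min ((c.stack 0).takeWhile id).length (n + 2) with hm
  set l := ((c.stack 0).dropWhile id).tail with hl
  have hlL : l.length ≤ L := by
    refine le_trans ?_ (hc 0)
    rw [hl, List.length_tail]
    exact (Nat.sub_le _ _).trans (List.dropWhile_sublist _).length_le
  obtain ⟨d₃, hd₃, k0, k2, k3, k4, k5, k6⟩ : ∃ d, RunsIn ex coin readUnary d₂ (6 * L + 5) d ∧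
      d.stack 0 = l ∧ d.stack 2 = List.replicate m true ∧ d.stack 3 = [] ∧ d.stack 4 = [] ∧
      d.stack 5 = [] ∧ d.stack 6 = [] := by
    refine ⟨_, (runsIn_readUnary d₂ g3).of ?_ rfl, ?_⟩
    · have := hc 0
      rw [g0]
      omega
    · simp [Config.stack_set, g0, g1, g2, g4, g5, g6, ← hl, ← hm]
  refine ⟨_, (hd₁.seq <| hd₂.seq <| hd₃.seq <| (runsIn_moveRev (by norm_num) _).seq <|
    (runsIn_pushBits _ _ _).seq <| (runsIn_pour (by simp) _).seq <|
    (runsIn_writeOrs m m _ ?_ ?_ ?_).seq <| (runsIn_pushBits _ _ _).seq <|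
    (runsIn_moveRev (by norm_num) _).seq (runsIn_pushBits _ _ _)).of ?_ rfl, ?_⟩
  · simp [Config.stack_set, Config.addTrues, k2, k3]
  · simp [Config.stack_set, Config.addTrues, k2, k5]
  · simp [Config.stack_set, Config.addTrues, k6]
  · have hmn : m ≤ n + 2 := min_le_right _ _
    have hmul : m * (9 * m + 16) ≤ (n + 2) * (9 * n + 34) := Nat.mul_le_mul hmn (by omega)
    have e : m * (9 * m + 16) = m * (9 * m + 11) + m * 5 := by ring
    simp [Config.stack_set, Config.addTrues, k0, k2, k4, Gate.encode, unary]
    omega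
  · simp [Config.stack_set, Config.addTrues, k0, k4]

/-- The original gates survive unaltered, since new gates only follow them. Only the unary header is
replaced and a tail appended. -/
theorem Circuit.encode_predictor (C : Circuit) (n : ℕ) :
    (C.predictor n).encode = unary 1 ++ ((C.encode.dropWhile id).tail ++
      ((Gate.const false).encode ++
      ((List.replicate (min (C.encode.takeWhile id).length (n + 2))
        (Gate.or 0 (min (C.encode.takeWhile id).length (n + 2)))).flatMap Gate.encode ++
      (Gate.not 0).encode))) := by
  have h1 : C.encode.takeWhile id = List.replicate C.numOut true := by
    simp [encode, unary, List.takeWhile_append_of_pos]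
  have h2 : C.encode.dropWhile id = false :: C.gates.flatMap Gate.encode := by
    simp [encode, unary, List.dropWhile_append_of_pos]
  rw [h1, h2, List.length_replicate, List.tail_cons]
  simp [encode, predictor, allZero]

end Programs

/-! ## The reduction -/

theorem eval_mono_nat {σ : Type*} (p : MvPolynomial σ ℕ) {f g : σ → ℕ} (h : ∀ i, f i ≤ g i) :
    MvPolynomial.eval f p ≤ MvPolynomial.eval g p := by
  rw [MvPolynomial.eval_eq, MvPolynomial.eval_eq]
  exact Finset.sum_le_sum fun d _ => Nat.mul_le_mul le_rfl
    (Finset.prod_le_prod' fun i _ => Nat.pow_le_pow_left (h i) _)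

/-- The program for learning parities that a program for learning generators gives rise to. -/
def parityLearner (m : ℕ) (A : Prog) : Prog := .seq (prepare m) (.seq A makePredictor)

theorem exists_run_parityLearner (m : ℕ) (A : Prog) {n a T t : ℕ} {l : List Bool}
    {ex : ℕ → List Bool} {coin : ℕ → Bool} (hex : ∀ i, (ex i).length = n + 1) {c : Config}
    (hr : Runs ex coin A (start [List.replicate (n + 1) true, List.replicate (4 * (n + 1)) true,
      List.replicate (m * a) true, l]) t c) (ht : t ≤ T) :
    ∃ d, RunsIn ex coin (parityLearner m A)
      (start [List.replicate n true, List.replicate a true, l])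
      (40 * l.length + a * (m + 3) + 140 * n + 188 + 32 * (m * a) + 32 * (T * (n + 1)) + T +
        (n + 2) * (9 * n + 34)) d ∧
      ∀ C : Circuit, c.stack 0 = C.encode → d.stack 0 = (C.predictor n).encode := by
  -- The learner may leave rubbish on any stack, but each step adds at most the `n + 1` bits of an
  -- example.
  have hlen : ∀ r, (c.stack r).length ≤ 4 * (n + 1) + m * a + l.length + T * (n + 1) := by
    intro r
    have h1 := hr.length_stack_le (K := n + 1) (fun i => (hex i).le) (by omega) r
    have h2 : t * (n + 1) ≤ T * (n + 1) := Nat.mul_le_mul_right _ ht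
    have h3 : ((start [List.replicate (n + 1) true, List.replicate (4 * (n + 1)) true,
      List.replicate (m * a) true, l]).stack r).length ≤ 4 * (n + 1) + m * a + l.length := by
      rcases r with _ | _ | _ | _ | r <;> simp [start] <;> omega
    omega
  obtain ⟨d, hd, h0⟩ := runsIn_makePredictor (coin := coin) hex c hlen
  refine ⟨d, ((runsIn_prepare m n a l).seq ((hr.runsIn.of ht rfl).seq hd)).of (by omega) rfl, fun C hC => ?_⟩
  rw [h0, hC, Circuit.encode_predictor]

theorem parityLearnable_of_generatorsLearnable (h : GeneratorsLearnable) (η : ℝ)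
    (hη : η ∈ Set.Ioo (0 : ℝ) (1 / 2)) : ParityLearnable η hη := by
  obtain ⟨A, T, hA⟩ := h
  obtain ⟨m, hm, hC⟩ := exists_errorRate_predictor_lt η hη
  open MvPolynomial in
  -- The time bound is evaluated at the rescaled arguments, with `b` in place of `Nat.log 2 b`:
  -- natural coefficients make it monotone, and polynomial dependence on `1/δ` is allowed for
  -- parities.
  let T' : MvPolynomial (Fin 3) ℕ :=
    bind₁ ![X 0 + 1, 4 * (X 0 + 1), C m * X 1, X 2] T
  refine ⟨parityLearner m A, 40 * .X 2 + .X 1 * (.C m + 3) + 140 * .X 0 + 188 +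
    32 * (.C m * .X 1) + 32 * (T' * (.X 0 + 1)) + T' + (.X 0 + 2) * (9 * .X 0 + 34), ?_⟩
  intro n a b ha hb args
  obtain ⟨hhalt, hsucc⟩ := hA (n + 1) (4 * (n + 1)) (m * a) b (by omega)
    (Nat.mul_pos hm ha) hb
  have hT' : MvPolynomial.eval ![n + 1, 4 * (n + 1), m * a, Nat.log 2 b] T
      ≤ MvPolynomial.eval ![n, a, b] T' := by
    have e : MvPolynomial.eval ![n, a, b] T'
        = MvPolynomial.eval ![n + 1, 4 * (n + 1), m * a, b] T := by
      simp only [T', MvPolynomial.eval, MvPolynomial.eval₂Hom_bind₁]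
      congr 2
      funext i
      fin_cases i <;> simp
    rw [e]
    refine eval_mono_nat T fun i => ?_
    fin_cases i <;> simp [Nat.log_le_self]
  have hbits : (Nat.bits b).length ≤ b := by
    rw [Nat.size_eq_bits_len]
    exact Nat.size_le.2 Nat.lt_two_pow_self
  constructor
  · intro ex coin
    obtain ⟨t, ht, c, hr⟩ := hhalt ex coin
    obtain ⟨d, ⟨u, hu, hd⟩, -⟩ := exists_run_parityLearner (n := n) (a := a) m A (by simp) hr
      (ht.trans hT')
    refine ⟨u, hu.trans ?_, d, hd⟩
    simp
    omega
  · intro S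
    set e : ParityState n ≃ Fin (4 * (n + 1)) := Fintype.equivFinOfCardEq (card_parityState n)
    have hG := hsucc ((parityGenerator S η hη).reindex e)
    rw [QuantumGenerator.outputDist_reindex, outputDist_parityGenerator] at hG
    refine hG.trans ?_
    unfold successProb
    -- Both programs are compared on the same examples and coin tosses, so success of the learner
    -- for generators implies success of the parity learner pointwise. The confidence is therefore
    -- unchanged.
    refine MeasureTheory.measureReal_mono ?_
    rintro ω ⟨C, ⟨t, c, hr, hc⟩, hgood⟩
    obtain ⟨d, ⟨u, -, hd⟩, hd'⟩ := exists_run_parityLearner (n := n) (a := a) m A (by simp) hr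
      le_rfl
    exact ⟨C.predictor n, ⟨u, d, hd, hd' C hc⟩, hC n S a C ha hgood⟩

end QG

theorem theorem3 :
    -- no algorithm learns the output distributions of quantum generators efficiently
    (QG.NoisyParityConjecture → ¬ QG.GeneratorsLearnable) ∧
    -- the explicit generator of noisy parities
    (∀ (n : ℕ) (S : Finset (Fin n)) (η : ℝ) (hη : η ∈ Set.Ioo (0 : ℝ) (1 / 2)),
      Fintype.card (QG.ParityState n) = 4 * (n + 1) ∧
      ∃ G : QG.QuantumGenerator (QG.ParityState n),
        G.init = Pi.single (0, false, false) 1 ∧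
        G.U = QG.parityMatrix S η ∧
        G.outcome = QG.parityOutcome S ∧
        G.outputDist (n + 1) = QG.noisyParity S η hη) ∧
    -- an evaluator for the noisy parity distribution yields a predictor for the parity
    (∀ (n : ℕ) (S : Finset (Fin n)) (η : ℝ) (hη : η ∈ Set.Ioo (0 : ℝ) (1 / 2)) (ε : ℝ), 0 < ε →
      ∀ Q : PMF (Fin (n + 1) → Bool),
        QG.klBits (QG.noisyParity S η hη) Q ≤ ENNReal.ofReal (ε * (1 - QG.entropyBits η)) →
        ∀ h : (Fin n → Bool) → Bool,
          (∀ (x : Fin n → Bool) (b : Bool),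
            Q (Fin.snoc (α := fun _ => Bool) x (!b)) < Q (Fin.snoc (α := fun _ => Bool) x b) →
              h x = b) →
          QG.errorRate (QG.parity S) h ≤ ε) :=
  ⟨fun ⟨η, hη, hnot⟩ h => hnot (QG.parityLearnable_of_generatorsLearnable h η hη),
    fun n S η hη => ⟨QG.card_parityState n, QG.parityGenerator S η hη, rfl, rfl, rfl,
      QG.outputDist_parityGenerator S η hη⟩,
    fun n => QG.errorRate_le_of_klBits_le (n := n)⟩
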